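/- Throughout, rings are associative with a non-zero identity element and modules are unitary. A module is *uniserial* if any two of its submodules are comparable with respect to inclusion, and *serial* if it is a direct sum of uniserial modules. A ring $R$ is *right serial* if the right module $R_R$ is serial, and *right Artinian* if $R_R$ is an Artinian module. For a ring $A$ with an automorphism $\varphi$, the *skew Laurent series ring* $A((x,\varphi))$ consists of the formal series $\sum_{i\ge m} a_i x^i$ with $m\in\mathbb{Z}$ and $a_i\in A$, with componentwise addition and with the multiplication determined by $xa=\varphi(a)x$, that is, $$\Bigl(\sum_i a_i x^i\Bigr)\Bigl(\sum_j b_j x^j\Bigr)=\sum_n\Bigl(\sum_{i+j=n} a_i\varphi^i(b_j)\Bigr)x^n .$$ **Theorem 1.** Let $A$ be a ring and $\varphi$ an automorphism of $A$. The following conditions are equivalent. 1. $A((x,\varphi))$ is a right serial ring. 2. $A((x,\varphi))$ is a right serial right Artinian ring. 3. $A$ is a right serial right Artinian ring. -/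

import Mathlib

universe u v

/-- A module is uniserial if any two of its submodules are comparable with respect to inclusion. -/
def IsUniserialModule (R : Type u) (M : Type v) [Semiring R] [AddCommMonoid M] [Module R M] :
    Prop :=
  ∀ N P : Submodule R M, N ≤ P ∨ P ≤ N

open Classical in
/-- A module is serial if it is a direct sum of uniserial modules, that is, the internal direct
sum of a family of uniserial submodules. -/
def IsSerialModule (R : Type u) (M : Type v) [Semiring R] [AddCommMonoid M] [Module R M] :
    Prop :=
  ∃ (ι : Type v) (N : ι → Submodule R M),
    DirectSum.IsInternal N ∧ ∀ i, IsUniserialModule R (N i)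

/-- A ring `R` is right serial if the right module `R_R` is serial. Right `R`-modules are modules
over the opposite ring `Rᵐᵒᵖ`, which acts on `R` by right multiplication; the submodules of `R_R`
are the right ideals of `R`. -/
def IsRightSerialRing (R : Type u) [Ring R] : Prop :=
  IsSerialModule Rᵐᵒᵖ R

/-- A ring `R` is right Artinian if the right module `R_R` is Artinian (descending chain condition
on right ideals). -/
def IsRightArtinianRing (R : Type u) [Ring R] : Prop :=
  IsArtinian Rᵐᵒᵖ R

/-- The skew Laurent series `∑ aᵢ xⁱ` (`i ∈ ℤ`) with coefficients in `A`, only finitely many of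
which with negative index are non-zero. The automorphism `φ` determines the multiplication. -/
@[ext]
structure SkewLaurentSeries {A : Type u} [Ring A] (φ : A ≃+* A) where
  /-- the coefficient of `xⁱ` -/
  coeff : ℤ → A
  bddBelow' : ∃ m : ℤ, ∀ i < m, coeff i = 0

namespace SkewLaurentSeries

variable {A : Type u} [Ring A] {φ : A ≃+* A}

instance : Zero (SkewLaurentSeries φ) := ⟨⟨fun _ => 0, 0, fun _ _ => rfl⟩⟩

instance : One (SkewLaurentSeries φ) :=
  ⟨⟨fun i => if i = 0 then 1 else 0, 0, fun _ hi => if_neg hi.ne⟩⟩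

instance : Add (SkewLaurentSeries φ) :=
  ⟨fun f g => ⟨fun i => f.coeff i + g.coeff i, by
    obtain ⟨a, ha⟩ := f.bddBelow'
    obtain ⟨b, hb⟩ := g.bddBelow'
    refine ⟨min a b, fun i hi => ?_⟩
    rw [ha i (lt_of_lt_of_le hi (min_le_left _ _)), hb i (lt_of_lt_of_le hi (min_le_right _ _)),
      add_zero]⟩⟩

instance : Neg (SkewLaurentSeries φ) :=
  ⟨fun f => ⟨fun i => -f.coeff i, by
    obtain ⟨a, ha⟩ := f.bddBelow'
    exact ⟨a, fun i hi => by rw [ha i hi, neg_zero]⟩⟩⟩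

/-- The `i`-th summand `aᵢ φⁱ(bₙ₋ᵢ)` of the `n`-th coefficient of a product. -/
def mulTerm (f g : SkewLaurentSeries φ) (n i : ℤ) : A :=
  f.coeff i * (φ ^ i : RingAut A) (g.coeff (n - i))

theorem mulTerm_eq_zero {f g : SkewLaurentSeries φ} {a b : ℤ} (ha : ∀ i < a, f.coeff i = 0)
    (hb : ∀ i < b, g.coeff i = 0) {n i : ℤ} (h : i < a ∨ n - b < i) : mulTerm f g n i = 0 := by
  rcases h with h | h
  · rw [mulTerm, ha i h, zero_mul]
  · rw [mulTerm, hb (n - i) (by omega), map_zero, mul_zero]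

/-- Multiplication determined by `x a = φ(a) x`, that is,
`(∑ aᵢ xⁱ)(∑ bⱼ xʲ) = ∑ₙ (∑ᵢ aᵢ φⁱ(bₙ₋ᵢ)) xⁿ`. The inner sums have only finitely many non-zero
terms. -/
noncomputable instance : Mul (SkewLaurentSeries φ) :=
  ⟨fun f g => ⟨fun n => ∑ᶠ i : ℤ, mulTerm f g n i, by
    obtain ⟨a, ha⟩ := f.bddBelow'
    obtain ⟨b, hb⟩ := g.bddBelow'
    refine ⟨a + b, fun n hn => ?_⟩
    rw [← finsum_zero (α := ℤ)]
    exact finsum_congr fun i => mulTerm_eq_zero ha hb (by omega)⟩⟩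

@[simp] theorem coeff_zero (i : ℤ) : (0 : SkewLaurentSeries φ).coeff i = 0 := rfl

theorem coeff_one (i : ℤ) : (1 : SkewLaurentSeries φ).coeff i = if i = 0 then 1 else 0 := rfl

@[simp] theorem coeff_add (f g : SkewLaurentSeries φ) (i : ℤ) :
    (f + g).coeff i = f.coeff i + g.coeff i := rfl

@[simp] theorem coeff_neg (f : SkewLaurentSeries φ) (i : ℤ) : (-f).coeff i = -f.coeff i := rfl

theorem coeff_mul (f g : SkewLaurentSeries φ) (n : ℤ) :
    (f * g).coeff n = ∑ᶠ i : ℤ, f.coeff i * (φ ^ i : RingAut A) (g.coeff (n - i)) := rfl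

theorem coeff_mul_eq_sum {f g : SkewLaurentSeries φ} {a b : ℤ} (ha : ∀ i < a, f.coeff i = 0)
    (hb : ∀ i < b, g.coeff i = 0) {n p q : ℤ} (hp : p ≤ a) (hq : n - b ≤ q) :
    (f * g).coeff n =
      ∑ i ∈ Finset.Icc p q, f.coeff i * (φ ^ i : RingAut A) (g.coeff (n - i)) := by
  refine finsum_eq_sum_of_support_subset (mulTerm f g n) fun i hi => ?_
  rw [Finset.coe_Icc, Set.mem_Icc]
  by_contra h
  exact hi (mulTerm_eq_zero ha hb (by omega))

theorem coeff_mul_eq_zero {f g : SkewLaurentSeries φ} {a b : ℤ} (ha : ∀ i < a, f.coeff i = 0)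
    (hb : ∀ i < b, g.coeff i = 0) : ∀ n < a + b, (f * g).coeff n = 0 := fun n hn => by
  rw [coeff_mul_eq_sum ha hb le_rfl le_rfl, Finset.Icc_eq_empty (by omega), Finset.sum_empty]

protected theorem mul_assoc (f g h : SkewLaurentSeries φ) : f * g * h = f * (g * h) := by
  obtain ⟨a, ha⟩ := f.bddBelow'
  obtain ⟨b, hb⟩ := g.bddBelow'
  obtain ⟨c, hc⟩ := h.bddBelow'
  ext n
  rw [coeff_mul_eq_sum (coeff_mul_eq_zero ha hb) hc (p := a + b) (q := n - c) le_rfl le_rfl,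
    coeff_mul_eq_sum ha (coeff_mul_eq_zero hb hc) (p := a) (q := n - b - c) le_rfl (by omega)]
  have h1 : ∀ k ∈ Finset.Icc (a + b) (n - c),
      (f * g).coeff k * (φ ^ k : RingAut A) (h.coeff (n - k)) =
        ∑ i ∈ Finset.Icc a (n - b - c), f.coeff i * (φ ^ i : RingAut A) (g.coeff (k - i)) *
          (φ ^ k : RingAut A) (h.coeff (n - k)) := by
    intro k hk
    rw [Finset.mem_Icc] at hk
    rw [coeff_mul_eq_sum ha hb (p := a) (q := n - b - c) le_rfl (by omega), Finset.sum_mul]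
  rw [Finset.sum_congr rfl h1, Finset.sum_comm]
  refine Finset.sum_congr rfl fun i hi => ?_
  rw [Finset.mem_Icc] at hi
  rw [coeff_mul_eq_sum hb hc (n := n - i) (p := a + b - i) (q := n - c - i) (by omega) (by omega),
    map_sum, Finset.mul_sum]
  refine Finset.sum_bij' (fun k _ => k - i) (fun j _ => j + i) ?_ ?_ ?_ ?_ ?_
  · intro k hk
    rw [Finset.mem_Icc] at hk ⊢
    omega
  · intro j hj
    rw [Finset.mem_Icc] at hj ⊢
    omega
  · intro k _
    omega
  · intro j _
    omega
  · intro k _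
    have e1 : (φ ^ k : RingAut A) (h.coeff (n - k)) =
        (φ ^ i : RingAut A) ((φ ^ (k - i) : RingAut A) (h.coeff (n - k))) := by
      rw [← RingAut.mul_apply, ← zpow_add]
      congr 2
      omega
    rw [e1, map_mul, mul_assoc, show n - i - (k - i) = n - k by omega]

/-- The skew Laurent series ring `A((x, φ))`. -/
noncomputable instance : Ring (SkewLaurentSeries φ) where
  add_assoc f g h := by ext i; exact add_assoc _ _ _
  zero_add f := by ext i; exact zero_add _
  add_zero f := by ext i; exact add_zero _
  add_comm f g := by ext i; exact add_comm _ _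
  neg_add_cancel f := by ext i; exact neg_add_cancel _
  nsmul := nsmulRec
  zsmul := zsmulRec
  mul_assoc := SkewLaurentSeries.mul_assoc
  one_mul f := by
    ext n
    rw [coeff_mul, finsum_eq_single _ 0 fun i hi => by rw [coeff_one, if_neg hi, zero_mul]]
    simp [coeff_one]
  mul_one f := by
    ext n
    rw [coeff_mul, finsum_eq_single _ n fun i hi => by
      rw [coeff_one, if_neg (by omega), map_zero, mul_zero]]
    simp [coeff_one]
  zero_mul f := by
    ext n
    rw [coeff_mul, coeff_zero, ← finsum_zero (α := ℤ)]
    exact finsum_congr fun i => by rw [coeff_zero, zero_mul]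
  mul_zero f := by
    ext n
    rw [coeff_mul, coeff_zero, ← finsum_zero (α := ℤ)]
    exact finsum_congr fun i => by rw [coeff_zero, map_zero, mul_zero]
  left_distrib f g h := by
    obtain ⟨a, ha⟩ := f.bddBelow'
    obtain ⟨b, hb⟩ := g.bddBelow'
    obtain ⟨c, hc⟩ := h.bddBelow'
    obtain ⟨d, hd⟩ := (g + h).bddBelow'
    ext n
    have hq : ∀ e ∈ ({b, c, d} : Finset ℤ), n - e ≤ n - min b (min c d) := by
      simp only [Finset.mem_insert, Finset.mem_singleton]
      omega
    rw [coeff_add, coeff_mul_eq_sum ha hb le_rfl (hq b (by simp)),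
      coeff_mul_eq_sum ha hc le_rfl (hq c (by simp)),
      coeff_mul_eq_sum ha hd le_rfl (hq d (by simp)), ← Finset.sum_add_distrib]
    exact Finset.sum_congr rfl fun i _ => by rw [coeff_add, map_add, mul_add]
  right_distrib f g h := by
    obtain ⟨a, ha⟩ := f.bddBelow'
    obtain ⟨b, hb⟩ := g.bddBelow'
    obtain ⟨c, hc⟩ := h.bddBelow'
    obtain ⟨d, hd⟩ := (f + g).bddBelow'
    ext n
    have hp : ∀ e ∈ ({a, b, d} : Finset ℤ), min a (min b d) ≤ e := by
      simp
    rw [coeff_add, coeff_mul_eq_sum ha hc (hp a (by simp)) le_rfl,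
      coeff_mul_eq_sum hb hc (hp b (by simp)) le_rfl,
      coeff_mul_eq_sum hd hc (hp d (by simp)) le_rfl, ← Finset.sum_add_distrib]
    exact Finset.sum_congr rfl fun i _ => by rw [coeff_add, add_mul]

end SkewLaurentSeries

/-!
Write `R` for `A((x, φ))`. Right ideals are submodules over the opposite ring. Two constructions link
the right ideals of `A` and of `R`: a right ideal `P` of `A` gives the right ideal `laurent φ P` of all
series with coefficients in `P`, and a right ideal `I` of `R` gives the right ideal `lead I` of the
lowest coefficients of its elements. The first is strictly monotone; so is the second when `A` is
right Noetherian, by successive approximation (`le_of_lead_le`).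

*From `A` to `R`.* Let `A` be right serial and right Artinian, with radical `J`, and let `V` be one of
its uniserial summands. Given a series `f` with coefficients in `V`, let `a` be the first
coefficient that generates the right ideal of all the coefficients. Then `f = a u`, where `u` has a
coefficient `1` preceded by coefficients in `J`. As `J` is nilpotent and `φ`-invariant, `u` is right
invertible, so `fR = aR` (`exists_span_monomial_eq`). Hence cyclic submodules of `laurent φ V` are
comparable because those of `V` are, and `R` is the direct sum of the uniserial modules `laurent φ V`.

*From `R` to chain conditions on `A`.* Let `R` be right serial, a sum of `n` uniserial modules. Of any
`n + 1` elements of `R` one lies in the right ideal generated by the others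
(`exists_mem_span_erase`), whereas a strictly ascending chain of right ideals of `A` yields `n + 1`
lacunary series for which this fails; so `A`, and therefore `R`, is right Noetherian. If `A` is
semiprime, then the radical of `R` is zero: for `f` in the radical, `1 + f x⁻¹` is right invertible,
and if the lowest coefficient of `f` has the smallest possible right annihilator, then comparing lowest
coefficients shows that the radical contains a unit modulo that annihilator, which is absurd
(`eq_bot_of_forall_one_add`).
Factoring out the largest nilpotent ideal of `A` shows that the radical of `R` is nilpotent in general.
As `R` is serial, it is semisimple modulo its radical; so `R` is right Artinian by the
Hopkins–Levitzki theorem, and so is `A`, by means of `laurent`.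

*From `R` to seriality of `A`.* Once `A` is right Artinian, it is a direct sum of indecomposable right
ideals `V = eA`, and by Fitting's lemma every element of `V` outside `J` generates `V`. Consequently
every series with coefficients in `V`, but not all in `J`, generates `laurent φ V`. This applies to
`e y` for some `y` in a uniserial summand `U` of `R`, so `laurent φ V = eU` is uniserial, and then so is
`V` (`isUniserialModule_of_indecomposable`).
-/

open MulOpposite

theorem rightIdeal_mul_mem {S : Type*} [Ring S] (P : Submodule Sᵐᵒᵖ S) {a : S} (b : S) (ha : a ∈ P) :
    a * b ∈ P :=
  P.smul_mem (op b) ha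

namespace SkewLaurentSeries

variable {A : Type u} [Ring A] {φ : A ≃+* A}

/-! ### Monomials -/

/-- The monomial `a xⁱ`. -/
def monomial (φ : A ≃+* A) (i : ℤ) (a : A) : SkewLaurentSeries φ :=
  ⟨fun n => if n = i then a else 0, i, fun _ hn => if_neg hn.ne⟩

theorem coeff_monomial (i n : ℤ) (a : A) :
    (monomial φ i a).coeff n = if n = i then a else 0 := rfl

theorem coeff_monomial_mul (i n : ℤ) (a : A) (f : SkewLaurentSeries φ) :
    (monomial φ i a * f).coeff n = a * (φ ^ i : RingAut A) (f.coeff (n - i)) := by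
  rw [coeff_mul, finsum_eq_single _ i fun j hj => by rw [coeff_monomial, if_neg hj, zero_mul],
    coeff_monomial, if_pos rfl]

theorem coeff_mul_monomial (j n : ℤ) (b : A) (f : SkewLaurentSeries φ) :
    (f * monomial φ j b).coeff n = f.coeff (n - j) * (φ ^ (n - j) : RingAut A) b := by
  rw [coeff_mul, finsum_eq_single _ (n - j) fun i hi => by
    rw [coeff_monomial, if_neg (by omega), map_zero, mul_zero], coeff_monomial,
    if_pos (by omega)]

@[simp]
theorem coeff_sub (f g : SkewLaurentSeries φ) (n : ℤ) :
    (f - g).coeff n = f.coeff n - g.coeff n := by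
  rw [sub_eq_add_neg, coeff_add, coeff_neg, sub_eq_add_neg]

@[simp]
theorem coeff_sum {ι : Type*} (s : Finset ι) (f : ι → SkewLaurentSeries φ) (n : ℤ) :
    (∑ i ∈ s, f i).coeff n = ∑ i ∈ s, (f i).coeff n :=
  map_sum (⟨⟨fun f => f.coeff n, rfl⟩, fun _ _ => rfl⟩ : SkewLaurentSeries φ →+ A) f s

theorem monomial_mul_monomial (i j : ℤ) (a b : A) :
    monomial φ i a * monomial φ j b = monomial φ (i + j) (a * (φ ^ i : RingAut A) b) := by
  ext n
  rw [coeff_monomial_mul, coeff_monomial, coeff_monomial]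
  by_cases h : n = i + j
  · rw [if_pos h, if_pos (by omega)]
  · rw [if_neg h, if_neg (by omega), map_zero, mul_zero]

theorem monomial_zero_one : monomial φ 0 1 = 1 := rfl

theorem mul_monomial_mul_monomial_neg (f : SkewLaurentSeries φ) (i : ℤ) :
    f * monomial φ i 1 * monomial φ (-i) 1 = f := by
  rw [mul_assoc, monomial_mul_monomial, map_one, mul_one, add_neg_cancel, monomial_zero_one,
    mul_one]

theorem coeff_mul_mem (P : AddSubgroup A) {f g : SkewLaurentSeries φ} {n : ℤ}
    (h : ∀ i, f.coeff i * (φ ^ i : RingAut A) (g.coeff (n - i)) ∈ P) : (f * g).coeff n ∈ P := by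
  obtain ⟨a, ha⟩ := f.bddBelow'
  obtain ⟨b, hb⟩ := g.bddBelow'
  rw [coeff_mul_eq_sum ha hb le_rfl le_rfl]
  exact sum_mem fun i _ => h i

theorem eq_zero_of_forall_coeff {f : SkewLaurentSeries φ} (h : ∀ n, f.coeff n = 0) : f = 0 := by
  ext n
  exact h n

/-- The first index at which the coefficients of a series satisfy a given property, which is to
fail for `0`. -/
theorem exists_minimal_index (f : SkewLaurentSeries φ) (p : A → Prop) (h0 : ¬ p 0)
    (h : ∃ n, p (f.coeff n)) : ∃ m, p (f.coeff m) ∧ ∀ n < m, ¬ p (f.coeff n) := by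
  obtain ⟨a, ha⟩ := f.bddBelow'
  obtain ⟨m, hm, hmin⟩ := Int.exists_least_of_bdd (P := fun n => p (f.coeff n))
    ⟨a, fun z hz => by
      by_contra hza
      rw [ha z (by omega)] at hz
      exact h0 hz⟩ h
  exact ⟨m, hm, fun n hn hp => by have := hmin n hp; omega⟩

/-! ### Right ideals of the coefficient ring and of the series ring -/

/-- The right ideal `P((x, φ))` of all series with coefficients in a right ideal `P` of `A`. -/
def laurent (φ : A ≃+* A) (P : Submodule Aᵐᵒᵖ A) :
    Submodule (SkewLaurentSeries φ)ᵐᵒᵖ (SkewLaurentSeries φ) where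
  carrier := {f | ∀ n, f.coeff n ∈ P}
  add_mem' hf hg n := P.add_mem (hf n) (hg n)
  zero_mem' _ := P.zero_mem
  smul_mem' g f hf n := by
    rw [MulOpposite.smul_eq_mul_unop]
    exact coeff_mul_mem P.toAddSubgroup fun i => rightIdeal_mul_mem P _ (hf i)

theorem monomial_mem_laurent {P : Submodule Aᵐᵒᵖ A} {i : ℤ} {a : A} :
    monomial φ i a ∈ laurent φ P ↔ a ∈ P := by
  refine ⟨fun h => by simpa [coeff_monomial] using h i, fun h n => ?_⟩
  rw [coeff_monomial]
  split_ifs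
  exacts [h, P.zero_mem]

theorem laurent_le_laurent {P Q : Submodule Aᵐᵒᵖ A} : laurent φ P ≤ laurent φ Q ↔ P ≤ Q :=
  ⟨fun h _ ha => monomial_mem_laurent.1 (h (monomial_mem_laurent (i := 0).2 ha)),
    fun h _ hf n => h (hf n)⟩

theorem laurent_strictMono : StrictMono (laurent φ) := fun _ _ h =>
  lt_of_le_not_ge (laurent_le_laurent.2 h.le) fun h' => h.not_ge (laurent_le_laurent.1 h')

/-- The right ideal of the constant coefficients of those elements of a right ideal `I` of
`A((x, φ))` that have no terms of negative degree. As `x` is a unit, these are all the lowest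
coefficients of elements of `I`. -/
def lead (I : Submodule (SkewLaurentSeries φ)ᵐᵒᵖ (SkewLaurentSeries φ)) : Submodule Aᵐᵒᵖ A where
  carrier := {a | ∃ f ∈ I, (∀ n < 0, f.coeff n = 0) ∧ f.coeff 0 = a}
  add_mem' := by
    rintro _ _ ⟨f, hf, hf0, rfl⟩ ⟨g, hg, hg0, rfl⟩
    exact ⟨f + g, I.add_mem hf hg, fun n hn => by rw [coeff_add, hf0 n hn, hg0 n hn, add_zero],
      rfl⟩
  zero_mem' := ⟨0, I.zero_mem, fun _ _ => rfl, rfl⟩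
  smul_mem' := by
    rintro b _ ⟨f, hf, hf0, rfl⟩
    refine ⟨f * monomial φ 0 b.unop, rightIdeal_mul_mem I _ hf, fun n hn => ?_, ?_⟩
    · rw [coeff_mul_monomial, sub_zero, hf0 n hn, zero_mul]
    · rw [coeff_mul_monomial, sub_zero, zpow_zero]
      rfl

theorem coeff_mem_lead {I : Submodule (SkewLaurentSeries φ)ᵐᵒᵖ (SkewLaurentSeries φ)}
    {f : SkewLaurentSeries φ} (hf : f ∈ I) {m : ℤ} (h : ∀ n < m, f.coeff n = 0) :
    f.coeff m ∈ lead I := by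
  refine ⟨f * monomial φ (-m) 1, rightIdeal_mul_mem I _ hf, fun n hn => ?_, ?_⟩
  · rw [coeff_mul_monomial, h _ (by omega), zero_mul]
  · rw [coeff_mul_monomial, map_one, mul_one, zero_sub, neg_neg]

theorem lead_mono {I I' : Submodule (SkewLaurentSeries φ)ᵐᵒᵖ (SkewLaurentSeries φ)}
    (h : I ≤ I') : lead I ≤ lead I' := by
  rintro _ ⟨f, hf, hf0, rfl⟩
  exact ⟨f, h hf, hf0, rfl⟩

/-- Nested right ideals `P ≤ Q` of `A((x, φ))` are equal if they have the same lowest coefficients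
and these form a finitely generated right ideal: any series in `Q` is obtained by successive
approximation as `∑ fᵢ gᵢ`, where the `fᵢ` are finitely many elements of `P` whose lowest
coefficients generate. -/
theorem le_of_lead_le {P Q : Submodule (SkewLaurentSeries φ)ᵐᵒᵖ (SkewLaurentSeries φ)}
    (hPQ : P ≤ Q) (hfg : (lead P).FG) (h : lead Q ≤ lead P) : Q ≤ P := by
  obtain ⟨r, c, hc⟩ := Submodule.fg_iff_exists_fin_generating_family.1 hfg
  have hcP : ∀ i, c i ∈ lead P := fun i => hc ▸ Submodule.subset_span ⟨i, rfl⟩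
  choose f hfP hf0 hfc using hcP
  have step : ∀ (g : SkewLaurentSeries φ) (k : ℕ), ∃ b : Fin r → A,
      g ∈ Q → (∀ n < (k : ℤ), g.coeff n = 0) →
        ∀ n < (k : ℤ) + 1, (g - ∑ i, f i * monomial φ k (b i)).coeff n = 0 := by
    intro g k
    by_cases hg : g ∈ Q ∧ ∀ n < (k : ℤ), g.coeff n = 0
    · have hk : g.coeff k ∈ Submodule.span Aᵐᵒᵖ (Set.range c) :=
        hc ▸ h (coeff_mem_lead hg.1 hg.2)
      obtain ⟨b, hb⟩ := (Submodule.mem_span_range_iff_exists_fun Aᵐᵒᵖ).1 hk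
      refine ⟨fun i => (b i).unop, fun _ _ n hn => ?_⟩
      rw [coeff_sub, coeff_sum]
      rcases (show n < k ∨ n = k by omega) with hn | rfl
      · rw [hg.2 n hn, Finset.sum_eq_zero fun i _ => by
          rw [coeff_mul_monomial, hf0 i _ (by omega), zero_mul], sub_zero]
      · rw [sub_eq_zero, ← hb]
        refine Finset.sum_congr rfl fun i _ => ?_
        rw [coeff_mul_monomial, sub_self, zpow_zero, hfc]
        rfl
    · exact ⟨0, fun h1 h2 => absurd ⟨h1, h2⟩ hg⟩
  choose b hb using step
  have main : ∀ g ∈ Q, (∀ n < 0, g.coeff n = 0) → g ∈ P := by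
    intro g hg hg0
    obtain ⟨G, hGz, hGs⟩ : ∃ G : ℕ → SkewLaurentSeries φ,
        G 0 = g ∧ ∀ k : ℕ, G (k + 1) = G k - ∑ i, f i * monomial φ k (b (G k) k i) :=
      ⟨fun k => Nat.rec g (fun k Gk => Gk - ∑ i, f i * monomial φ k (b Gk k i)) k, rfl,
        fun _ => rfl⟩
    have hG : ∀ k : ℕ, G k ∈ Q ∧ ∀ n < (k : ℤ), (G k).coeff n = 0 := by
      intro k
      induction k with
      | zero => exact hGz ▸ ⟨hg, fun n hn => hg0 n (by simpa using hn)⟩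
      | succ k ih =>
        refine ⟨?_, fun n hn => ?_⟩
        · rw [hGs]
          exact Q.sub_mem ih.1 (sum_mem fun i _ => rightIdeal_mul_mem Q _ (hPQ (hfP i)))
        · rw [hGs]
          exact hb _ k ih.1 ih.2 n (by push_cast at hn; exact hn)
    let B : Fin r → SkewLaurentSeries φ := fun i =>
      ⟨fun n => if 0 ≤ n then b (G n.toNat) n.toNat i else 0, 0, fun n hn => if_neg (by omega)⟩
    let T : ℕ → Fin r → SkewLaurentSeries φ := fun k i =>
      ∑ l ∈ Finset.range k, monomial φ l (b (G l) l i)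
    have hT : ∀ k, G k = g - ∑ i, f i * T k i := by
      intro k
      induction k with
      | zero => simp [T, hGz]
      | succ k ih =>
        rw [hGs, ih, sub_sub, ← Finset.sum_add_distrib]
        congr 1
        refine Finset.sum_congr rfl fun i _ => ?_
        rw [← mul_add, ← ih]
        simp only [T, Finset.sum_range_succ]
    have hBT : ∀ (k : ℕ) i, ∀ n < (k : ℤ), (B i - T k i).coeff n = 0 := by
      intro k i n hn
      simp only [T, B, coeff_sub, coeff_sum, coeff_monomial]
      split_ifs with h0
      · rw [Finset.sum_eq_single n.toNat, if_pos (by omega), sub_self]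
        · intro l _ hl
          rw [if_neg (by omega)]
        · intro hl
          exact absurd (Finset.mem_range.2 (by omega)) hl
      · rw [Finset.sum_eq_zero fun l _ => if_neg (by omega), sub_zero]
    have hgB : g = ∑ i, f i * B i := by
      ext n
      have h1 : g - ∑ i, f i * B i =
          G (n.toNat + 1) - ∑ i, f i * (B i - T (n.toNat + 1) i) := by
        rw [hT]
        simp only [mul_sub, Finset.sum_sub_distrib]
        abel
      rw [← sub_eq_zero, ← coeff_sub, h1, coeff_sub, (hG (n.toNat + 1)).2 n (by push_cast; omega), coeff_sum,
        Finset.sum_eq_zero, sub_zero]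
      intro i _
      exact coeff_mul_eq_zero (hf0 i) (hBT (n.toNat + 1) i) n (by push_cast; omega)
    rw [hgB]
    exact sum_mem fun i _ => rightIdeal_mul_mem P _ (hfP i)
  intro g hg
  obtain ⟨m, hm⟩ := g.bddBelow'
  have := main (g * monomial φ (-m) 1) (rightIdeal_mul_mem Q _ hg) fun n hn => by
    rw [coeff_mul_monomial, hm _ (by omega), zero_mul]
  have h2 := rightIdeal_mul_mem P (monomial φ m 1) this
  have h3 := mul_monomial_mul_monomial_neg g (-m)
  rw [neg_neg] at h3
  rwa [h3] at h2

theorem lead_strictMono [IsNoetherian Aᵐᵒᵖ A] : StrictMono (lead (φ := φ)) := fun _ _ h =>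
  lt_of_le_not_ge (lead_mono h.le) fun h' =>
    h.not_ge (le_of_lead_le h.le (IsNoetherian.noetherian _) h')

theorem isNoetherian_of_coeff [IsNoetherian Aᵐᵒᵖ A] :
    IsNoetherian (SkewLaurentSeries φ)ᵐᵒᵖ (SkewLaurentSeries φ) :=
  isNoetherian_iff'.2 (lead_strictMono (φ := φ)).wellFoundedGT

theorem coeff_isArtinian [IsArtinian (SkewLaurentSeries φ)ᵐᵒᵖ (SkewLaurentSeries φ)] :
    IsArtinian Aᵐᵒᵖ A :=
  (laurent_strictMono (φ := φ)).wellFoundedLT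

/-- A power series with constant coefficient `1` is right invertible. -/
theorem exists_mul_eq_one {f : SkewLaurentSeries φ} (hf : ∀ n < 0, f.coeff n = 0)
    (hf0 : f.coeff 0 = 1) : ∃ g, f * g = 1 := by
  have hmem : f ∈ Submodule.span (SkewLaurentSeries φ)ᵐᵒᵖ {f} := Submodule.mem_span_singleton_self f
  have htop : lead (Submodule.span (SkewLaurentSeries φ)ᵐᵒᵖ {f}) = ⊤ := by
    refine eq_top_iff.2 fun a _ => ?_
    have := rightIdeal_mul_mem _ a (coeff_mem_lead hmem (m := 0) hf)
    rwa [hf0, one_mul] at this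
  have hfg : (⊤ : Submodule Aᵐᵒᵖ A).FG := ⟨{1}, eq_top_iff.2 fun a _ => by
    rw [Finset.coe_singleton, Submodule.mem_span_singleton]
    exact ⟨op a, one_mul a⟩⟩
  have h1 := le_of_lead_le (Q := ⊤) le_top (htop ▸ hfg) (htop ▸ le_top) (x := 1) trivial
  obtain ⟨g, hg⟩ := Submodule.mem_span_singleton.1 h1
  exact ⟨g.unop, hg⟩

end SkewLaurentSeries

/-! ### Right modules over a ring and left modules over the opposite ring -/

section Opposite

variable {S : Type*} [Ring S]

/-- A ring, as a right module over itself, is the regular left module of the opposite ring. -/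
def rightRegularEquiv (S : Type*) [Ring S] : S ≃ₗ[Sᵐᵒᵖ] Sᵐᵒᵖ :=
  { opAddEquiv with map_smul' := fun _ _ => rfl }

theorem isArtinianRing_op_iff : IsArtinianRing Sᵐᵒᵖ ↔ IsArtinian Sᵐᵒᵖ S :=
  (LinearEquiv.isArtinian_iff (rightRegularEquiv S)).symm

theorem isNoetherianRing_op_iff : IsNoetherianRing Sᵐᵒᵖ ↔ IsNoetherian Sᵐᵒᵖ S :=
  isNoetherianRing_iff.trans (LinearEquiv.isNoetherian_iff (rightRegularEquiv S)).symm

theorem isNoetherian_of_isArtinian_right [IsArtinian Sᵐᵒᵖ S] : IsNoetherian Sᵐᵒᵖ S :=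
  have := isArtinianRing_op_iff.2 ‹IsArtinian Sᵐᵒᵖ S›
  isNoetherianRing_op_iff.1 inferInstance

theorem mem_span_singleton_right {a b : S} :
    b ∈ Submodule.span Sᵐᵒᵖ {a} ↔ ∃ c, a * c = b :=
  Submodule.mem_span_singleton.trans ⟨fun ⟨c, hc⟩ => ⟨c.unop, hc⟩, fun ⟨c, hc⟩ => ⟨op c, hc⟩⟩

/-- A two-sided ideal, as a right ideal. -/
def Ideal.toRight (I : Ideal S) [I.IsTwoSided] :
    Submodule Sᵐᵒᵖ S where
  carrier := I
  add_mem' := I.add_mem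
  zero_mem' := I.zero_mem
  smul_mem' b _ ha := I.mul_mem_right b.unop ha

end Opposite

/-! ### The Jacobson radical of the right regular module -/

section RightJacobson

variable {S : Type*} [Ring S]

/-- The Jacobson radical of `S`, defined by maximal right ideals, that is, by maximal left ideals
of the opposite ring. -/
def rightJacobson (S : Type*) [Ring S] : Ideal S where
  carrier := {a | op a ∈ Ring.jacobson Sᵐᵒᵖ}
  add_mem' := (Ring.jacobson Sᵐᵒᵖ).add_mem
  zero_mem' := (Ring.jacobson Sᵐᵒᵖ).zero_mem
  smul_mem' c _ ha := (Ring.jacobson Sᵐᵒᵖ).mul_mem_right (op c) ha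

theorem mem_rightJacobson {a : S} : a ∈ rightJacobson S ↔ op a ∈ Ring.jacobson Sᵐᵒᵖ := Iff.rfl

instance : (rightJacobson S).IsTwoSided :=
  ⟨fun b ha => (Ring.jacobson Sᵐᵒᵖ).mul_mem_left (op b) ha⟩

theorem map_mem_rightJacobson (e : S ≃+* S) {a : S} (ha : a ∈ rightJacobson S) :
    e a ∈ rightJacobson S := by
  have : RingHomSurjective (e.op : Sᵐᵒᵖ →+* Sᵐᵒᵖ) := ⟨e.op.surjective⟩
  exact Ring.le_comap_jacobson (e.op : Sᵐᵒᵖ →+* Sᵐᵒᵖ) ha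

theorem exists_one_add_mul_eq_one {a : S} (ha : a ∈ rightJacobson S) :
    ∃ b, (1 + a) * b = 1 := by
  rw [mem_rightJacobson, ← Ideal.jacobson_bot, Ideal.mem_jacobson_iff] at ha
  obtain ⟨z, hz⟩ := ha 1
  refine ⟨z.unop, op_injective ?_⟩
  rw [Ideal.mem_bot, sub_eq_zero, mul_one] at hz
  rw [op_mul, op_add, op_one, op_unop, mul_add, mul_one, add_comm, hz]

theorem mem_rightJacobson_of_isNilpotent {a : S} (h : ∀ b, IsNilpotent (a * b)) :
    a ∈ rightJacobson S := by
  rw [mem_rightJacobson, ← Ideal.jacobson_bot, Ideal.mem_jacobson_iff]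
  intro y
  obtain ⟨z, hz⟩ := (h y.unop).isUnit_one_add.exists_right_inv
  refine ⟨op z, ?_⟩
  have := congrArg op hz
  rw [op_mul, op_add, op_mul, op_unop, op_one, mul_add, mul_one, add_comm, ← mul_assoc] at this
  rw [this, sub_self]
  exact Ideal.zero_mem _

theorem Ideal.pow_mem_pow_of_mem {K : Ideal S} {f : S} (hf : f ∈ K)
    (k : ℕ) : f ^ k ∈ K ^ k := by
  induction k with
  | zero => rw [Submodule.pow_zero, Ideal.one_eq_top]; trivial
  | succ k ih =>
    rw [Submodule.pow_succ, pow_succ]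
    exact Ideal.mul_mem_mul ih hf

theorem op_mem_pow {I : Ideal S} {K : Ideal Sᵐᵒᵖ} [K.IsTwoSided] (h : ∀ a ∈ I, op a ∈ K) (n : ℕ) :
    ∀ a ∈ I ^ n, op a ∈ K ^ n := by
  induction n with
  | zero => exact fun a _ => by rw [Submodule.pow_zero, Ideal.one_eq_top]; trivial
  | succ n ih =>
    intro a ha
    rw [Submodule.pow_succ] at ha
    rw [Ideal.IsTwoSided.pow_succ]
    refine Submodule.mul_induction_on ha (fun b hb c hc => ?_) fun b c hb hc => ?_
    · exact Ideal.mul_mem_mul (h c hc) (ih b hb)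
    · exact Ideal.add_mem _ hb hc

theorem unop_mem_pow {I : Ideal S} {K : Ideal Sᵐᵒᵖ} [I.IsTwoSided] (h : ∀ a ∈ K, unop a ∈ I)
    (n : ℕ) : ∀ a ∈ K ^ n, unop a ∈ I ^ n := by
  induction n with
  | zero => exact fun a _ => by rw [Submodule.pow_zero, Ideal.one_eq_top]; trivial
  | succ n ih =>
    intro a ha
    rw [Submodule.pow_succ] at ha
    rw [Ideal.IsTwoSided.pow_succ]
    refine Submodule.mul_induction_on ha (fun b hb c hc => ?_) fun b c hb hc => ?_
    · exact Ideal.mul_mem_mul (h c hc) (ih b hb)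
    · exact Ideal.add_mem _ hb hc

theorem exists_rightJacobson_pow_eq_bot [IsArtinian Sᵐᵒᵖ S] : ∃ n, rightJacobson S ^ n = ⊥ := by
  have : IsArtinianRing Sᵐᵒᵖ := isArtinianRing_op_iff.2 inferInstance
  obtain ⟨n, hn⟩ := IsSemiprimaryRing.isNilpotent (R := Sᵐᵒᵖ)
  refine ⟨n, (Submodule.eq_bot_iff _).2 fun a ha => op_injective ?_⟩
  have := op_mem_pow (K := Ring.jacobson Sᵐᵒᵖ) (fun _ h => h) n a ha
  rw [hn] at this
  exact this

/-- Fitting's lemma for a right ideal `V` of a right Artinian ring: if `V` is indecomposable and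
`c ∈ V`, then left multiplication by `c` on `V` is either nilpotent or bijective. So `c` either
generates `V` or, with all its right multiples, is nilpotent. -/
theorem exists_mul_eq_of_notMem_rightJacobson [IsArtinian Sᵐᵒᵖ S] {V : Submodule Sᵐᵒᵖ S} {e : S}
    (he : e ∈ V)
    (hV : ∀ P Q : Submodule Sᵐᵒᵖ S, P ⊓ Q = ⊥ → P ⊔ Q = V → P = ⊥ ∨ Q = ⊥) {c : S} (hc : c ∈ V)
    (hcJ : c ∉ rightJacobson S) : ∃ b, c * b = e := by
  have : IsNoetherian Sᵐᵒᵖ S := isNoetherian_of_isArtinian_right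
  by_contra hne
  have key : ∀ d ∈ V, (∀ b, d * b ≠ e) → IsNilpotent d := by
    intro d hd hde
    let f : Module.End Sᵐᵒᵖ V :=
      { toFun := fun v => ⟨d * v, rightIdeal_mul_mem _ _ hd⟩
        map_add' := fun v w => Subtype.ext (mul_add _ _ _)
        map_smul' := fun s v => Subtype.ext (mul_assoc d v.1 s.unop).symm }
    have hf : ∀ (n : ℕ) (v : V), ((f ^ n) v : S) = d ^ n * v := by
      intro n
      induction n with
      | zero => intro v; simp
      | succ n ih =>
        intro v
        rw [pow_succ, Module.End.mul_apply, ih, pow_succ, mul_assoc]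
        rfl
    obtain ⟨n, hn, hn0⟩ := (f.eventually_isCompl_ker_pow_range_pow.and
      (Filter.eventually_ge_atTop 1)).exists
    rcases hV ((LinearMap.ker (f ^ n)).map V.subtype) ((LinearMap.range (f ^ n)).map V.subtype)
      (by rw [← Submodule.map_inf _ V.injective_subtype, hn.inf_eq_bot, Submodule.map_bot])
      (by rw [← Submodule.map_sup, hn.sup_eq_top, Submodule.map_subtype_top]) with h | h
    · replace h := Submodule.map_injective_of_injective V.injective_subtype
        (h.trans (Submodule.map_bot _).symm)
      have htop : LinearMap.range (f ^ n) = ⊤ := by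
        have := hn.sup_eq_top
        rwa [h, bot_sup_eq] at this
      obtain ⟨v, hv⟩ := LinearMap.range_eq_top.1 htop ⟨e, he⟩
      have hv' := congrArg Subtype.val hv
      rw [hf, ← Nat.sub_add_cancel hn0, pow_succ', mul_assoc] at hv'
      exact absurd hv' (hde _)
    · replace h := Submodule.map_injective_of_injective V.injective_subtype
        (h.trans (Submodule.map_bot _).symm)
      refine ⟨n + 1, ?_⟩
      have := hf n ⟨d, hd⟩
      rw [LinearMap.range_eq_bot.1 h] at this
      rw [pow_succ, ← this]
      rfl
  refine hcJ (mem_rightJacobson_of_isNilpotent fun b => key _ (rightIdeal_mul_mem _ _ hc) fun b' h => ?_)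
  exact hne ⟨b * b', by rw [← mul_assoc, h]⟩

end RightJacobson

namespace SkewLaurentSeries

variable {A : Type u} [Ring A] {φ : A ≃+* A}

/-! ### Series with coefficients in an invariant ideal -/

/-- The ideal `I((x, φ))` of all series with coefficients in a `φ`-invariant two-sided ideal
`I`. -/
def laurentIdeal (I : Ideal A) [I.IsTwoSided]
    (hI : ∀ i : ℤ, ∀ a ∈ I, (φ ^ i : RingAut A) a ∈ I) : Ideal (SkewLaurentSeries φ) where
  carrier := {f | ∀ n, f.coeff n ∈ I}
  add_mem' hf hg n := I.add_mem (hf n) (hg n)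
  zero_mem' _ := I.zero_mem
  smul_mem' _ _ hf _ := coeff_mul_mem I.toAddSubgroup fun _ => I.mul_mem_left _ (hI _ _ (hf _))

variable {I : Ideal A} [I.IsTwoSided] {hI : ∀ i : ℤ, ∀ a ∈ I, (φ ^ i : RingAut A) a ∈ I}

theorem mem_laurentIdeal {f : SkewLaurentSeries φ} :
    f ∈ laurentIdeal I hI ↔ ∀ n, f.coeff n ∈ I := Iff.rfl

instance : (laurentIdeal I hI).IsTwoSided :=
  ⟨fun _ ha _ => coeff_mul_mem I.toAddSubgroup fun i => I.mul_mem_right _ (ha i)⟩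

theorem zpow_mem_of_mem {I : Ideal A} (h : ∀ a ∈ I, φ a ∈ I) (h' : ∀ a ∈ I, φ.symm a ∈ I) (i : ℤ) :
    ∀ a ∈ I, (φ ^ i : RingAut A) a ∈ I := by
  induction i using Int.induction_on with
  | zero => exact fun a ha => ha
  | succ i ih =>
    intro a ha
    rw [zpow_add_one, RingAut.mul_apply]
    exact ih _ (h a ha)
  | pred i ih =>
    intro a ha
    rw [zpow_sub_one, RingAut.mul_apply]
    exact ih _ (h' a ha)

theorem coeff_mem_pow {K : Ideal (SkewLaurentSeries φ)} (hK : K ≤ laurentIdeal I hI) (k : ℕ) :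
    ∀ f ∈ K ^ k, ∀ n, f.coeff n ∈ I ^ k := by
  induction k with
  | zero => exact fun f _ n => by rw [Submodule.pow_zero, Ideal.one_eq_top]; trivial
  | succ k ih =>
    intro f hf
    rw [Submodule.pow_succ] at hf
    refine Submodule.mul_induction_on hf (fun g hg h hh n => ?_) fun g h hg hh n => ?_
    · refine coeff_mul_mem (I ^ (k + 1)).toAddSubgroup fun i => ?_
      rw [Submodule.pow_succ]
      exact Ideal.mul_mem_mul (ih g hg i) (hI _ _ (hK hh _))
    · exact Ideal.add_mem _ (hg n) (hh n)

theorem pow_eq_bot_of_le_laurentIdeal {K : Ideal (SkewLaurentSeries φ)}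
    (hK : K ≤ laurentIdeal I hI) {k : ℕ} (hk : I ^ k = ⊥) : K ^ k = ⊥ :=
  (Submodule.eq_bot_iff _).2 fun f hf => eq_zero_of_forall_coeff fun n => by
    have := coeff_mem_pow hK k f hf n
    rwa [hk, Ideal.mem_bot] at this

/-- A series is right invertible if one of its coefficients is `1` and all earlier ones lie in a
nilpotent `φ`-invariant ideal. -/
theorem exists_mul_eq_one_of_lower_mem {k : ℕ} (hk : I ^ k = ⊥)
    (hI : ∀ i : ℤ, ∀ a ∈ I, (φ ^ i : RingAut A) a ∈ I) {f : SkewLaurentSeries φ} {i : ℤ}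
    (hlow : ∀ n < i, f.coeff n ∈ I) (hi : f.coeff i = 1) : ∃ g, f * g = 1 := by
  -- `v` is the part of `f` in degrees at least `i`, shifted to start in degree `0`
  let v : SkewLaurentSeries φ :=
    ⟨fun n => if n < 0 then 0 else f.coeff (n + i), 0, fun n hn => if_pos hn⟩
  obtain ⟨w, hw⟩ := exists_mul_eq_one (f := v) (fun n hn => if_pos hn) (by simp [v, hi])
  have hmem : f * monomial φ (-i) 1 - v ∈ laurentIdeal I hI := by
    intro n
    rw [coeff_sub, coeff_mul_monomial, map_one, mul_one, sub_neg_eq_add]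
    simp only [v]
    split_ifs with h
    · rw [sub_zero]
      exact hlow _ (by omega)
    · rw [sub_self]
      exact I.zero_mem
  have hnil : IsNilpotent ((f * monomial φ (-i) 1 - v) * w) := ⟨k, by
    have := Ideal.pow_mem_pow_of_mem (Ideal.mul_mem_right w _ hmem) k
    rwa [pow_eq_bot_of_le_laurentIdeal le_rfl hk, Ideal.mem_bot] at this⟩
  obtain ⟨t, ht⟩ := hnil.isUnit_one_add.exists_right_inv
  refine ⟨monomial φ (-i) 1 * (w * t), ?_⟩
  rw [← hw, ← add_mul, add_sub_cancel, mul_assoc] at ht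
  rw [← mul_assoc, ht, hw]

/-- Let `V = eA` with `e` idempotent be such that every element of `V` outside the nilpotent ideal
`I` generates `V`. Then the right ideal `V((x, φ))` has the same property with respect to
`I((x, φ))`. -/
theorem exists_mul_eq_of_notMem_laurentIdeal {k : ℕ} (hk : I ^ k = ⊥) {V : Submodule Aᵐᵒᵖ A}
    {e : A} (he : e ∈ V) (hev : ∀ v ∈ V, e * v = v) (hV : ∀ c ∈ V, c ∉ I → ∃ b, c * b = e)
    {f : SkewLaurentSeries φ} (hf : f ∈ laurent φ V) (hfI : f ∉ laurentIdeal I hI) :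
    ∃ g, f * g = monomial φ 0 e := by
  obtain ⟨i, hi, hlow⟩ := exists_minimal_index f (· ∉ I) (fun h => h I.zero_mem)
    (by simpa [mem_laurentIdeal] using hfI)
  obtain ⟨b, hb⟩ := hV _ (hf i) hi
  -- after multiplication by `x⁻ⁱ b` the coefficient at `0` is `e`
  set f' := f * monomial φ (-i) ((φ ^ (-i) : RingAut A) b) with hf'
  have hf'V : f' ∈ laurent φ V := rightIdeal_mul_mem _ _ hf
  have hef' : monomial φ 0 e * f' = f' := by
    ext n
    rw [coeff_monomial_mul, sub_zero, zpow_zero]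
    exact hev _ (hf'V n)
  have hee : monomial φ 0 e * monomial φ 0 e = monomial φ 0 e := by
    rw [monomial_mul_monomial, zpow_zero, add_zero]
    exact congrArg _ (hev e he)
  obtain ⟨g, hg⟩ := exists_mul_eq_one_of_lower_mem hk hI (f := f' + (1 - monomial φ 0 e)) (i := 0)
    (fun n hn => by
      rw [coeff_add, coeff_sub, coeff_one, coeff_monomial, if_neg hn.ne, if_neg hn.ne, sub_zero,
        add_zero, hf', coeff_mul_monomial]
      exact I.mul_mem_right _ (not_not.1 (hlow _ (by omega))))
    (by
      rw [coeff_add, coeff_sub, coeff_one, coeff_monomial, if_pos rfl, if_pos rfl, hf',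
        coeff_mul_monomial, zero_sub, neg_neg, ← RingAut.mul_apply, ← zpow_add, add_neg_cancel,
        zpow_zero]
      change f.coeff i * b + _ = 1
      rw [hb, add_sub_cancel])
  refine ⟨monomial φ (-i) ((φ ^ (-i) : RingAut A) b) * g, ?_⟩
  have := congrArg (monomial φ 0 e * ·) hg
  simp only [← mul_assoc, mul_add, mul_sub, hef', hee, mul_one, sub_self, add_zero] at this
  rw [← mul_assoc, ← hf', this]

end SkewLaurentSeries

/-! ### Uniserial submodules and direct decompositions -/

section Uniserial

variable {T : Type*} {M : Type*} [Ring T] [AddCommGroup M] [Module T M]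

theorem isUniserialModule_iff {U : Submodule T M} :
    IsUniserialModule T U ↔ ∀ P ≤ U, ∀ Q ≤ U, P ≤ Q ∨ Q ≤ P := by
  refine ⟨fun h P hP Q hQ => ?_, fun h P Q => ?_⟩
  · rcases h (P.comap U.subtype) (Q.comap U.subtype) with h | h
    · exact Or.inl fun x hx => h (x := ⟨x, hP hx⟩) hx
    · exact Or.inr fun x hx => h (x := ⟨x, hQ hx⟩) hx
  · rcases h _ (Submodule.map_subtype_le U P) _ (Submodule.map_subtype_le U Q) with h | h
    · exact Or.inl ((Submodule.map_le_map_iff_of_injective U.injective_subtype _ _).1 h)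
    · exact Or.inr ((Submodule.map_le_map_iff_of_injective U.injective_subtype _ _).1 h)

theorem IsUniserialModule.eq_bot_or_eq_bot {U P Q : Submodule T M} (hU : IsUniserialModule T U)
    (h : P ⊓ Q = ⊥) (hPQ : P ⊔ Q = U) : P = ⊥ ∨ Q = ⊥ := by
  rcases isUniserialModule_iff.1 hU P (hPQ ▸ le_sup_left) Q (hPQ ▸ le_sup_right) with h' | h'
  · exact Or.inl (by rwa [inf_eq_left.2 h'] at h)
  · exact Or.inr (by rwa [inf_eq_right.2 h'] at h)

/-- It suffices to compare cyclic submodules. -/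
theorem isUniserialModule_of_span_singleton {U : Submodule T M}
    (h : ∀ x ∈ U, ∀ y ∈ U, x ∈ Submodule.span T {y} ∨ y ∈ Submodule.span T {x}) :
    IsUniserialModule T U := by
  refine isUniserialModule_iff.2 fun P hP Q hQ => ?_
  by_contra! hne
  obtain ⟨x, hxP, hxQ⟩ := SetLike.not_le_iff_exists.1 hne.1
  obtain ⟨y, hyQ, hyP⟩ := SetLike.not_le_iff_exists.1 hne.2
  rcases h x (hP hxP) y (hQ hyQ) with h | h
  · exact hxQ ((Submodule.span_singleton_le_iff_mem _ _).2 hyQ h)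
  · exact hyP ((Submodule.span_singleton_le_iff_mem _ _).2 hxP h)

theorem isSerialModule_iff {R : Type u} {M : Type v} [Ring R] [AddCommGroup M] [Module R M] :
    IsSerialModule R M ↔ ∃ (ι : Type v) (N : ι → Submodule R M),
      iSupIndep N ∧ ⨆ i, N i = ⊤ ∧ ∀ i, IsUniserialModule R (N i) := by
  classical
  refine exists₂_congr fun ι N => ?_
  rw [DirectSum.isInternal_submodule_iff_iSupIndep_and_iSup_eq_top, and_assoc]

end Uniserial

section Idempotent

variable {S : Type*} [Ring S]

/-- A direct summand of the right regular module is generated by an idempotent. -/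
theorem exists_idempotent_of_isCompl {V W : Submodule Sᵐᵒᵖ S} (h : IsCompl V W) :
    ∃ e ∈ V, ∀ v ∈ V, e * v = v := by
  obtain ⟨e, he, e', he', hee⟩ := Submodule.mem_sup.1 (h.sup_eq_top ▸ Submodule.mem_top (x := 1))
  refine ⟨e, he, fun v hv => ?_⟩
  have h1 : v - e * v = e' * v := by
    rw [sub_eq_iff_eq_add, ← add_mul, add_comm, hee, one_mul]
  have h2 : v - e * v ∈ V ⊓ W :=
    ⟨V.sub_mem hv (rightIdeal_mul_mem V v he), h1 ▸ rightIdeal_mul_mem W v he'⟩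
  rw [h.inf_eq_bot, Submodule.mem_bot, sub_eq_zero] at h2
  exact h2.symm

end Idempotent

/-! ### Ascent of seriality -/

namespace SkewLaurentSeries

variable {A : Type u} [Ring A] {φ : A ≃+* A}

theorem monomial_add (i : ℤ) (a b : A) :
    monomial φ i (a + b) = monomial φ i a + monomial φ i b := by
  ext n
  rw [coeff_add]
  simp only [coeff_monomial]
  split_ifs <;> simp

theorem iSupIndep_laurent {ι : Type*} {N : ι → Submodule Aᵐᵒᵖ A} (hN : iSupIndep N) :
    iSupIndep fun i => laurent φ (N i) := by
  intro i
  refine Submodule.disjoint_def.2 fun f hf hf' => eq_zero_of_forall_coeff fun n => ?_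
  have h : (⨆ (j) (_ : j ≠ i), laurent φ (N j)) ≤ laurent φ (⨆ (j) (_ : j ≠ i), N j) :=
    iSup₂_le fun j hj => laurent_le_laurent.2 (le_iSup₂ (f := fun j (_ : j ≠ i) => N j) j hj)
  exact Submodule.disjoint_def.1 (hN i) _ (hf n) (h hf' n)

theorem iSup_laurent {ι : Type*} {N : ι → Submodule Aᵐᵒᵖ A} (hN : ⨆ i, N i = ⊤) :
    ⨆ i, laurent φ (N i) = ⊤ := by
  refine eq_top_iff.2 fun f _ => ?_
  have key : ∀ a ∈ ⨆ i, N i, monomial φ 0 a ∈ ⨆ i, laurent φ (N i) := by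
    intro a ha
    refine Submodule.iSup_induction N (motive := fun a => monomial φ 0 a ∈ ⨆ i, laurent φ (N i)) ha
      (fun i a ha => le_iSup (fun i => laurent φ (N i)) i (monomial_mem_laurent.2 ha)) ?_
      fun a b ha hb => ?_
    · have h0 : monomial φ 0 (0 : A) = 0 := eq_zero_of_forall_coeff fun n => ite_self 0
      rw [h0]
      exact Submodule.zero_mem _
    · rw [monomial_add]
      exact Submodule.add_mem _ ha hb
  have := rightIdeal_mul_mem _ f (key 1 (hN ▸ Submodule.mem_top))
  rwa [monomial_zero_one, one_mul] at this

/-- A proper submodule of a cyclic submodule `aA` of a uniserial right module `V` is contained in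
the radical of `aA`. -/
theorem exists_mem_rightJacobson_of_mem_span [IsArtinian Aᵐᵒᵖ A] {ι : Type*}
    {N : ι → Submodule Aᵐᵒᵖ A} (hN : ⨆ i, N i = ⊤) (hu : ∀ i, IsUniserialModule Aᵐᵒᵖ (N i))
    {V : Submodule Aᵐᵒᵖ A} (hV : IsUniserialModule Aᵐᵒᵖ V) {a b : A} (ha : a ∈ V) (ha0 : a ≠ 0)
    (hab : ∀ c, a * b * c ≠ a) : ∃ b' ∈ rightJacobson A, a * b' = a * b := by
  -- `aA` is the sum of the chain of submodules `a Nᵢ`, so it is one of them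
  let l : A →ₗ[Aᵐᵒᵖ] A :=
    { toFun := fun s => a * s, map_add' := mul_add a, map_smul' := fun s t => (mul_assoc a t _).symm }
  have hl : ∀ i, (N i).map l ≤ V := fun i => Submodule.map_le_iff_le_comap.2 fun s _ =>
    rightIdeal_mul_mem V s ha
  have hsup : a ∈ ⨆ i, (N i).map l := by
    rw [← Submodule.map_iSup, hN]
    exact ⟨1, trivial, mul_one a⟩
  rcases isEmpty_or_nonempty ι with hι | hι
  · rw [iSup_of_empty, Submodule.mem_bot] at hsup
    exact absurd hsup ha0
  have hdir : Directed (· ≤ ·) fun i => (N i).map l := fun i j => by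
    rcases isUniserialModule_iff.1 hV _ (hl i) _ (hl j) with h | h
    exacts [⟨j, h, le_rfl⟩, ⟨i, le_rfl, h⟩]
  obtain ⟨i, w, hw, hwa⟩ := (Submodule.mem_iSup_of_directed _ hdir).1 hsup
  replace hwa : a * w = a := hwa
  refine ⟨w * b, ?_, by rw [← mul_assoc, hwa]⟩
  by_contra hJ
  obtain ⟨c, hc⟩ := exists_mul_eq_of_notMem_rightJacobson hw
    (fun P Q h => (hu i).eq_bot_or_eq_bot h) (rightIdeal_mul_mem _ b hw) hJ
  exact hab c (by rw [← hwa, mul_assoc a w b, mul_assoc, hc])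

theorem zpow_mem_rightJacobson (i : ℤ) :
    ∀ a ∈ rightJacobson A, (φ ^ i : RingAut A) a ∈ rightJacobson A :=
  fun _ ha => map_mem_rightJacobson (φ ^ i : RingAut A) ha

/-- Every cyclic submodule of `V((x, φ))` is generated by a constant: if `fₘ A` is the largest of the
right ideals `fₙ A` and `m` is minimal, then `f = fₘ u` for some `u` whose coefficient at `m` is `1`
and whose earlier coefficients lie in the radical. -/
theorem exists_span_monomial_eq [IsArtinian Aᵐᵒᵖ A] {ι : Type*}
    {N : ι → Submodule Aᵐᵒᵖ A} (hN : ⨆ i, N i = ⊤) (hu : ∀ i, IsUniserialModule Aᵐᵒᵖ (N i))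
    {V : Submodule Aᵐᵒᵖ A} (hV : IsUniserialModule Aᵐᵒᵖ V) {f : SkewLaurentSeries φ}
    (hf : f ∈ laurent φ V) :
    ∃ a ∈ V, (∃ g, monomial φ 0 a * g = f) ∧ ∃ g, f * g = monomial φ 0 a := by
  have : IsNoetherian Aᵐᵒᵖ A := isNoetherian_of_isArtinian_right
  by_cases hf0 : ∀ n, f.coeff n = 0
  · have h0 : monomial φ 0 (0 : A) = 0 := eq_zero_of_forall_coeff fun n => ite_self 0
    rw [eq_zero_of_forall_coeff hf0]
    exact ⟨0, V.zero_mem, ⟨0, mul_zero _⟩, ⟨0, by rw [mul_zero, h0]⟩⟩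
  obtain ⟨_, ⟨i, rfl⟩, hmax⟩ := set_has_maximal_iff_noetherian.2 ‹IsNoetherian Aᵐᵒᵖ A›
    (Set.range fun n => Submodule.span Aᵐᵒᵖ {f.coeff n}) (Set.range_nonempty _)
  have hle : ∀ n, Submodule.span Aᵐᵒᵖ {f.coeff n} ≤ V := fun n =>
    (Submodule.span_singleton_le_iff_mem _ _).2 (hf n)
  have hi : ∀ n, ∃ b, f.coeff i * b = f.coeff n := fun n => by
    refine mem_span_singleton_right.1 ?_
    rcases isUniserialModule_iff.1 hV _ (hle n) _ (hle i) with h | h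
    · exact h (Submodule.mem_span_singleton_self _)
    · exact (h.eq_or_lt.resolve_right (hmax _ ⟨n, rfl⟩)) ▸ Submodule.mem_span_singleton_self _
  obtain ⟨m, hm, hmin⟩ := exists_minimal_index f (fun c => ∀ n, ∃ b, c * b = f.coeff n)
    (fun h => hf0 fun n => by obtain ⟨b, hb⟩ := h n; rw [← hb, zero_mul]) ⟨i, hi⟩
  have ha0 : f.coeff m ≠ 0 := fun h0 => hf0 fun n => by
    obtain ⟨b, hb⟩ := hm n
    rw [← hb, h0, zero_mul]
  have hex : ∀ n, ∃ b, f.coeff m * b = f.coeff n ∧ (n < m → b ∈ rightJacobson A) ∧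
      (n = m → b = 1) ∧ (f.coeff n = 0 → b = 0) := by
    intro n
    by_cases h0 : f.coeff n = 0
    · exact ⟨0, by rw [h0, mul_zero], fun _ => Ideal.zero_mem _, fun h => absurd (h ▸ h0) ha0,
        fun _ => rfl⟩
    rcases lt_trichotomy n m with h | rfl | h
    · obtain ⟨b, hb⟩ := hm n
      obtain ⟨b', hb'J, hb'⟩ := exists_mem_rightJacobson_of_mem_span hN hu hV (hf m) ha0 (b := b)
        fun c hc => hmin n h fun k => by
          obtain ⟨d, hd⟩ := hm k
          exact ⟨c * d, by rw [← mul_assoc, ← hb, hc, hd]⟩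
      exact ⟨b', hb'.trans hb, fun _ => hb'J, fun h' => absurd h' h.ne, fun h' => absurd h' h0⟩
    · exact ⟨1, mul_one _, fun h => absurd h (lt_irrefl _), fun _ => rfl, fun h' => absurd h' h0⟩
    · obtain ⟨b, hb⟩ := hm n
      exact ⟨b, hb, fun h' => absurd h' h.not_gt, fun h' => absurd h' h.ne',
        fun h' => absurd h' h0⟩
  choose b hb hbJ hb1 hb0 using hex
  obtain ⟨k, hk⟩ := exists_rightJacobson_pow_eq_bot (S := A)
  let w : SkewLaurentSeries φ := ⟨b, by
    obtain ⟨r, hr⟩ := f.bddBelow'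
    exact ⟨r, fun n hn => hb0 n (hr n hn)⟩⟩
  have hw : monomial φ 0 (f.coeff m) * w = f := by
    ext n
    rw [coeff_monomial_mul, sub_zero, zpow_zero]
    exact hb n
  obtain ⟨g, hg⟩ := exists_mul_eq_one_of_lower_mem hk zpow_mem_rightJacobson (f := w)
    (fun n hn => hbJ n hn) (hb1 m rfl)
  exact ⟨f.coeff m, hf m, ⟨w, hw⟩, ⟨g, by rw [← hw, mul_assoc, hg, mul_one, hw]⟩⟩

theorem isUniserialModule_laurent [IsArtinian Aᵐᵒᵖ A] {ι : Type*}
    {N : ι → Submodule Aᵐᵒᵖ A} (hN : ⨆ i, N i = ⊤) (hu : ∀ i, IsUniserialModule Aᵐᵒᵖ (N i))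
    {V : Submodule Aᵐᵒᵖ A} (hV : IsUniserialModule Aᵐᵒᵖ V) :
    IsUniserialModule (SkewLaurentSeries φ)ᵐᵒᵖ (laurent φ V) := by
  have key : ∀ f g : SkewLaurentSeries φ, ∀ a b s : A, a * s = b →
      (∃ t, f * t = monomial φ 0 a) → (∃ t, monomial φ 0 b * t = g) →
        g ∈ Submodule.span (SkewLaurentSeries φ)ᵐᵒᵖ {f} := by
    rintro f g a b s rfl ⟨t, ht⟩ ⟨t', ht'⟩
    refine mem_span_singleton_right.2 ⟨t * (monomial φ 0 s * t'), ?_⟩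
    rw [← mul_assoc, ht, ← mul_assoc, monomial_mul_monomial, zpow_zero]
    exact ht'
  refine isUniserialModule_of_span_singleton fun f hf g hg => ?_
  obtain ⟨a, ha, haf, hfa⟩ := exists_span_monomial_eq hN hu hV hf
  obtain ⟨b, hb, hbg, hgb⟩ := exists_span_monomial_eq hN hu hV hg
  rcases isUniserialModule_iff.1 hV _ ((Submodule.span_singleton_le_iff_mem _ _).2 ha)
    _ ((Submodule.span_singleton_le_iff_mem _ _).2 hb) with h | h
  · obtain ⟨s, hs⟩ := mem_span_singleton_right.1 (h (Submodule.mem_span_singleton_self a))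
    exact Or.inl (key g f b a s hs hgb haf)
  · obtain ⟨s, hs⟩ := mem_span_singleton_right.1 (h (Submodule.mem_span_singleton_self b))
    exact Or.inr (key f g a b s hs hfa hbg)

theorem isRightSerialRing_of_coeff (hs : IsRightSerialRing A) (ha : IsRightArtinianRing A) :
    IsRightSerialRing (SkewLaurentSeries φ) := by
  have : IsArtinian Aᵐᵒᵖ A := ha
  obtain ⟨ι, N, hN, hsup, hu⟩ := isSerialModule_iff.1 hs
  exact isSerialModule_iff.2 ⟨ι, fun i => laurent φ (N i), iSupIndep_laurent hN,
    iSup_laurent hsup, fun i => isUniserialModule_laurent hsup hu (hu i)⟩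

end SkewLaurentSeries

/-! ### Exchange in sums of uniserial modules -/

section Exchange

variable {T : Type*} {M : Type*} [Ring T] [AddCommGroup M] [Module T M]

theorem IsUniserialModule.map {M' : Type*} [AddCommGroup M'] [Module T M'] {U : Submodule T M}
    (hU : IsUniserialModule T U) (l : M →ₗ[T] M') : IsUniserialModule T (U.map l) := by
  refine isUniserialModule_of_span_singleton ?_
  rintro _ ⟨x, hx, rfl⟩ _ ⟨y, hy, rfl⟩
  rw [← Set.image_singleton, ← Set.image_singleton, ← Submodule.map_span, ← Submodule.map_span]
  rcases isUniserialModule_iff.1 hU _ ((Submodule.span_singleton_le_iff_mem _ _).2 hx)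
    _ ((Submodule.span_singleton_le_iff_mem _ _).2 hy) with h | h
  · exact Or.inl ⟨x, h (Submodule.mem_span_singleton_self x), rfl⟩
  · exact Or.inr ⟨y, h (Submodule.mem_span_singleton_self y), rfl⟩

/-- Of more than `n` elements of a sum of `n` uniserial submodules, one lies in the span of the
others. The element whose component in one of the summands is largest serves to clear this
component from the other elements, as in Gaussian elimination. -/
theorem exists_mem_span_erase {κ ι : Type*} [DecidableEq κ] [DecidableEq ι]
    (U : κ → Submodule T M) (t : Finset κ) (hU : ∀ k ∈ t, IsUniserialModule T (U k)) :
    ∀ (s : Finset ι) (m : ι → M), t.card < s.card → (∀ i ∈ s, m i ∈ ⨆ k ∈ t, U k) →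
      ∃ j ∈ s, m j ∈ Submodule.span T (m '' (s.erase j : Finset ι)) := by
  induction t using Finset.induction_on with
  | empty =>
    intro s m hs hm
    obtain ⟨j, hj⟩ := Finset.card_pos.1 (by simpa using hs)
    have h0 : m j = 0 := by simpa using hm j hj
    exact ⟨j, hj, h0 ▸ Submodule.zero_mem _⟩
  | insert k t hk ih =>
    intro s m hs hm
    rw [Finset.card_insert_of_notMem hk] at hs
    have hdec : ∀ i, ∃ x ∈ U k, i ∈ s → m i - x ∈ ⨆ k ∈ t, U k := by
      intro i
      by_cases hi : i ∈ s
      · have := hm i hi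
        rw [Finset.iSup_insert, Submodule.mem_sup] at this
        obtain ⟨x, hx, y, hy, hxy⟩ := this
        exact ⟨x, hx, fun _ => by rwa [← hxy, add_sub_cancel_left]⟩
      · exact ⟨0, Submodule.zero_mem _, fun h => absurd h hi⟩
    choose x hx hmx using hdec
    have hle : ∀ i, Submodule.span T {x i} ≤ U k := fun i =>
      (Submodule.span_singleton_le_iff_mem _ _).2 (hx i)
    obtain ⟨p, hp, hpmax⟩ := s.exists_maximalFor (fun i => Submodule.span T {x i})
      (Finset.card_pos.1 (by omega))
    have hr : ∀ i, ∃ r : T, i ∈ s → r • x p = x i := by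
      intro i
      by_cases hi : i ∈ s
      · have : Submodule.span T {x i} ≤ Submodule.span T {x p} :=
          (isUniserialModule_iff.1 (hU k (Finset.mem_insert_self _ _)) _ (hle i) _ (hle p)).elim
            id fun h => hpmax hi h
        obtain ⟨r, hr⟩ := Submodule.mem_span_singleton.1
          (this (Submodule.mem_span_singleton_self (x i)))
        exact ⟨r, fun _ => hr⟩
      · exact ⟨0, fun h => absurd h hi⟩
    choose r hr using hr
    obtain ⟨j, hj, hjm⟩ := ih (fun k hk => hU k (Finset.mem_insert_of_mem hk)) (s.erase p)
      (fun i => m i - r i • m p) (by rw [Finset.card_erase_of_mem hp]; omega) fun i hi => by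
        have hi' := Finset.mem_of_mem_erase hi
        have h1 : m i - r i • m p = (m i - x i) - r i • (m p - x p) := by
          rw [smul_sub, hr i hi']
          abel
        rw [h1]
        exact Submodule.sub_mem _ (hmx i hi') (Submodule.smul_mem _ _ (hmx p hp))
    rw [Finset.mem_erase] at hj
    refine ⟨j, hj.2, ?_⟩
    have hpj : m p ∈ Submodule.span T (m '' (s.erase j : Finset ι)) :=
      Submodule.subset_span ⟨p, Finset.mem_coe.2 (Finset.mem_erase.2 ⟨hj.1.symm, hp⟩), rfl⟩
    rw [← sub_add_cancel (m j) (r j • m p)]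
    refine Submodule.add_mem _ (Submodule.span_le.2 ?_ hjm) (Submodule.smul_mem _ _ hpj)
    rintro _ ⟨i, hi, rfl⟩
    simp only [Finset.coe_erase, Set.mem_sdiff, Finset.mem_coe, Set.mem_singleton_iff] at hi
    exact Submodule.sub_mem _
      (Submodule.subset_span ⟨i, Finset.mem_coe.2 (Finset.mem_erase.2 ⟨hi.2, hi.1.1⟩), rfl⟩)
      (Submodule.smul_mem _ _ hpj)

end Exchange

/-! ### The coefficient ring of a serial series ring is right Noetherian -/

namespace SkewLaurentSeries

variable {A : Type u} [Ring A] {φ : A ≃+* A}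

/-- If `A` has a strictly ascending chain `I₀ < I₁ < ⋯` of right ideals with `aₛ ∈ Iₛ₊₁ \ Iₛ`, then,
for every `n`, the series `∑ aₛ x^(s²)` taken over the residue classes of `s` modulo `n + 1` are
`n + 1` elements none of which lies in the span of the others: as the gaps between the exponents
grow, a combination of the others has, at almost all exponents `s²` of the given one, its
coefficient in `Iₛ`. -/
theorem coeff_isNoetherian (hs : IsRightSerialRing (SkewLaurentSeries φ)) :
    IsNoetherian Aᵐᵒᵖ A := by
  classical
  obtain ⟨κ, U, -, hsup, hU⟩ := isSerialModule_iff.1 hs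
  obtain ⟨t, ht⟩ := (Submodule.mem_iSup_iff_exists_finset (p := U)
    (m := (1 : SkewLaurentSeries φ))).1 (hsup ▸ Submodule.mem_top)
  have hmem : ∀ f : SkewLaurentSeries φ, f ∈ ⨆ k ∈ t, U k := fun f => by
    have := rightIdeal_mul_mem _ f ht
    rwa [one_mul] at this
  by_contra hnoeth
  have hchain : ¬ WellFounded ((· > ·) : Submodule Aᵐᵒᵖ A → Submodule Aᵐᵒᵖ A → Prop) := fun h =>
    hnoeth (isNoetherian_iff'.2 ⟨h⟩)
  rw [RelEmbedding.wellFounded_iff_isEmpty, not_isEmpty_iff] at hchain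
  obtain ⟨I⟩ := hchain
  have hI : ∀ {s s' : ℕ}, s < s' → I s < I s' := fun h => I.map_rel_iff.2 h
  have hImono : ∀ {s s' : ℕ}, s ≤ s' → I s ≤ I s' := fun h =>
    h.eq_or_lt.elim (fun h => h ▸ le_rfl) fun h => (hI h).le
  choose a ha ha' using fun s => SetLike.exists_of_lt (hI (Nat.lt_succ_self s))
  set n := t.card + 1 with hn
  let F : ℕ → SkewLaurentSeries φ := fun j =>
    ⟨fun i => if 0 ≤ i ∧ i.toNat.sqrt ^ 2 = i.toNat ∧ i.toNat.sqrt % n = j then a i.toNat.sqrt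
      else 0, 0, fun i hi => if_neg fun h => by omega⟩
  obtain ⟨j, hj, hjF⟩ := exists_mem_span_erase U t (fun k _ => hU k) (Finset.range n) F
    (by rw [Finset.card_range]; omega) fun i _ => hmem _
  rw [Finset.mem_range] at hj
  have key : ∀ h ∈ Submodule.span (SkewLaurentSeries φ)ᵐᵒᵖ
      (F '' ((Finset.range n).erase j : Finset ℕ)), ∀ d : ℤ, ∃ k : ℕ, ∀ s ≥ k, s % n = j →
        ∀ i : ℤ, i ≤ (s : ℤ) ^ 2 + d → h.coeff i ∈ I s := by
    intro h hh
    induction hh using Submodule.span_induction with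
    | mem h hh =>
      obtain ⟨l, hl, rfl⟩ := hh
      have hlj : l ≠ j := (Finset.mem_erase.1 (Finset.mem_coe.1 hl)).1
      refine fun d => ⟨d.toNat, fun s hs hsj i hi => ?_⟩
      simp only [F]
      split_ifs with hc
      · obtain ⟨hi0, hsq, hmod⟩ := hc
        refine hImono ?_ (ha i.toNat.sqrt)
        generalize i.toNat.sqrt = r at hsq hmod
        have hne : r ≠ s := fun h => hlj (by rw [← hmod, h, hsj])
        have hlt : r < s + 1 := by
          by_contra! hle
          have h1 : (s + 1) ^ 2 ≤ r ^ 2 := Nat.pow_le_pow_left hle 2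
          have h2 : ((s : ℤ) + 1) ^ 2 ≤ i := by
            rw [← Int.toNat_of_nonneg hi0, ← hsq]
            exact_mod_cast h1
          have h3 : d ≤ s := by omega
          nlinarith
        omega
      · exact Submodule.zero_mem _
    | zero => exact fun d => ⟨0, fun s _ _ i _ => Submodule.zero_mem _⟩
    | add f g _ _ hf hg =>
      intro d
      obtain ⟨k, hk⟩ := hf d
      obtain ⟨k', hk'⟩ := hg d
      exact ⟨max k k', fun s hs hsj i hi => Submodule.add_mem _
        (hk s (le_of_max_le_left hs) hsj i hi) (hk' s (le_of_max_le_right hs) hsj i hi)⟩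
    | smul g f _ hf =>
      intro d
      obtain ⟨b, hb⟩ := g.unop.bddBelow'
      obtain ⟨k, hk⟩ := hf (d - b)
      refine ⟨k, fun s hs hsj i hi => ?_⟩
      rw [MulOpposite.smul_eq_mul_unop]
      refine coeff_mul_mem (I s).toAddSubgroup fun p => ?_
      by_cases hp : i - p < b
      · rw [hb _ hp, map_zero, mul_zero]
        exact Submodule.zero_mem _
      · exact rightIdeal_mul_mem (I s) _ (hk s hs hsj p (by omega))
  obtain ⟨k, hk⟩ := key (F j) hjF 0
  have hmod : (j + n * k) % n = j := by rw [Nat.add_mul_mod_self_left, Nat.mod_eq_of_lt hj]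
  have hge : j + n * k ≥ k := by nlinarith
  generalize j + n * k = s at hmod hge
  have := hk s hge hmod ((s : ℤ) ^ 2) (by omega)
  have hs2 : ((s : ℤ) ^ 2).toNat = s ^ 2 := by rw [← Nat.cast_pow, Int.toNat_natCast]
  simp only [F, hs2, Nat.sqrt_eq', hmod] at this
  rw [if_pos ⟨by positivity, trivial, trivial⟩] at this
  exact ha' s this

end SkewLaurentSeries

/-! ### Serial rings are semilocal -/

section Semisimple

variable {T : Type*} [Ring T]

theorem mem_jacobson_of_span_ne {U : Ideal T} (hU : IsUniserialModule T U) {x : T} (hx : x ∈ U)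
    (hne : Ideal.span {x} ≠ U) : x ∈ Ring.jacobson T := by
  rw [Ring.jacobson_eq_sInf_isMaximal, Submodule.mem_sInf]
  intro m hm
  by_contra hxm
  refine hne (le_antisymm ((Submodule.span_singleton_le_iff_mem _ _).2 hx) fun y hy => ?_)
  have hle : m ⊓ U ≤ Ideal.span {x} :=
    (isUniserialModule_iff.1 hU _ inf_le_right (Ideal.span {x})
      ((Submodule.span_singleton_le_iff_mem _ _).2 hx)).resolve_right fun h =>
        hxm (h (Ideal.mem_span_singleton_self x)).1
  -- the modular law: `U = (Tx + m) ∩ U = Tx + (m ∩ U) = Tx`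
  have htop : m ⊔ Ideal.span {x} = ⊤ := (Ideal.isMaximal_def.1 hm).2 _
    (left_lt_sup.2 fun h => hxm (h (Ideal.mem_span_singleton_self x)))
  obtain ⟨a, ha, b, hb, rfl⟩ := Submodule.mem_sup.1 (htop ▸ Submodule.mem_top (x := y))
  have haU : a ∈ U := by
    have := U.sub_mem hy ((Submodule.span_singleton_le_iff_mem _ _).2 hx hb)
    rwa [add_sub_cancel_right] at this
  exact Ideal.add_mem _ (hle ⟨ha, haU⟩) hb

/-- In a sum of uniserial left ideals, proper submodules of the summands lie in the radical, so the
images of the summands modulo the radical are simple or zero. -/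
theorem isSemisimpleRing_quotient_jacobson {ι : Type*} {U : ι → Ideal T} (hsup : ⨆ i, U i = ⊤)
    (hU : ∀ i, IsUniserialModule T (U i)) : IsSemisimpleRing (T ⧸ Ring.jacobson T) := by
  have hsurj : Function.Surjective (Ideal.Quotient.mk (Ring.jacobson T)) :=
    Ideal.Quotient.mk_surjective
  refine isSemisimpleModule_of_isSemisimpleModule_submodule'
    (p := fun i => (U i).map (Ideal.Quotient.mk (Ring.jacobson T))) (fun i => ?_) ?_
  · have key : ∀ P : Submodule (T ⧸ Ring.jacobson T) ((U i).map
        (Ideal.Quotient.mk (Ring.jacobson T))), P = ⊥ ∨ P = ⊤ := by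
      refine fun P => or_iff_not_imp_left.2 fun hP => eq_top_iff.2 ?_
      obtain ⟨⟨x', hx'⟩, hxP, hx0⟩ := P.ne_bot_iff.1 hP
      obtain ⟨x, hx, rfl⟩ := (Ideal.mem_map_iff_of_surjective _ hsurj).1 hx'
      have hxU : Ideal.span {x} = U i := by
        by_contra hne
        exact hx0 (Subtype.ext (Ideal.Quotient.eq_zero_iff_mem.2
          (mem_jacobson_of_span_ne (hU i) hx hne)))
      rintro ⟨y', hy'⟩ -
      obtain ⟨y, hy, rfl⟩ := (Ideal.mem_map_iff_of_surjective _ hsurj).1 hy'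
      obtain ⟨r, rfl⟩ := Ideal.mem_span_singleton'.1 (hxU ▸ hy)
      exact P.smul_mem (Ideal.Quotient.mk _ r) hxP
    refine { exists_isCompl := fun P => ?_ }
    rcases key P with rfl | rfl
    exacts [⟨⊤, isCompl_bot_top⟩, ⟨⊥, isCompl_top_bot⟩]
  · rw [← Ideal.map_iSup, hsup, Ideal.map_top]

end Semisimple

/-! ### Descent of seriality -/

section Decomposition

/-- In a modular lattice with descending chain condition, every complemented element is a finite
independent join of complemented elements that have no further decomposition. -/
theorem exists_supIndep_indecomposable {α : Type*} [Lattice α] [BoundedOrder α]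
    [IsModularLattice α] [WellFoundedLT α] (v : α) (hv : IsComplemented v) :
    ∃ s : Finset α, s.SupIndep id ∧ s.sup id = v ∧ ∀ p ∈ s, IsComplemented p ∧
      ∀ a b, a ⊓ b = ⊥ → a ⊔ b = p → a = ⊥ ∨ b = ⊥ := by
  classical
  induction v using WellFoundedLT.induction with
  | ind v ih =>
    by_cases hind : ∀ a b, a ⊓ b = ⊥ → a ⊔ b = v → a = ⊥ ∨ b = ⊥
    · refine ⟨{v}, Finset.supIndep_singleton _ _, Finset.sup_singleton, fun p hp => ?_⟩
      rw [Finset.mem_singleton] at hp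
      exact hp ▸ ⟨hv, hind⟩
    push Not at hind
    obtain ⟨a, b, hab, hsup, ha, hb⟩ := hind
    have key : ∀ a b : α, a ⊓ b = ⊥ → a ⊔ b = v → b ≠ ⊥ → a < v ∧ IsComplemented a := by
      intro a b hab hsup hb
      refine ⟨lt_of_le_of_ne (hsup ▸ le_sup_left) fun h => hb ?_, ?_⟩
      · rw [← hab, h, right_eq_inf, ← hsup]
        exact le_sup_right
      · obtain ⟨w, hw⟩ := hv
        refine ⟨b ⊔ w, ?_, ?_⟩
        · refine Disjoint.disjoint_sup_right_of_disjoint_sup_left (disjoint_iff.2 hab) ?_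
          rw [hsup]
          exact hw.disjoint
        · rw [codisjoint_iff, ← sup_assoc, hsup, hw.sup_eq_top]
    obtain ⟨hav, hac⟩ := key a b hab hsup hb
    obtain ⟨hbv, hbc⟩ := key b a (inf_comm a b ▸ hab) (sup_comm a b ▸ hsup) ha
    obtain ⟨s, hs, hsa, hs'⟩ := ih a hav hac
    obtain ⟨t, ht, htb, ht'⟩ := ih b hbv hbc
    refine ⟨s ∪ t, hs.union ht ?_, by rw [Finset.sup_union, hsa, htb, hsup], fun p hp => ?_⟩
    · rw [hsa, htb]
      exact disjoint_iff.2 hab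
    · exact (Finset.mem_union.1 hp).elim (hs' p) (ht' p)

end Decomposition

namespace SkewLaurentSeries

variable {A : Type u} [Ring A] {φ : A ≃+* A}

/-- An indecomposable direct summand `V = eA` of `A` is uniserial: as `e` lies outside the radical,
so does `e y` for some `y` in one of the uniserial summands `U` of the series ring, and then
`V((x, φ)) = eU`. -/
theorem isUniserialModule_of_indecomposable [IsArtinian Aᵐᵒᵖ A] {ι : Type*}
    {U : ι → Submodule (SkewLaurentSeries φ)ᵐᵒᵖ (SkewLaurentSeries φ)} (hsup : ⨆ i, U i = ⊤)
    (hU : ∀ i, IsUniserialModule (SkewLaurentSeries φ)ᵐᵒᵖ (U i)) {V : Submodule Aᵐᵒᵖ A}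
    (hV : IsComplemented V)
    (hind : ∀ P Q : Submodule Aᵐᵒᵖ A, P ⊓ Q = ⊥ → P ⊔ Q = V → P = ⊥ ∨ Q = ⊥) :
    IsUniserialModule Aᵐᵒᵖ V := by
  obtain ⟨W, hW⟩ := hV
  obtain ⟨e, he, hev⟩ := exists_idempotent_of_isCompl hW
  obtain ⟨k, hk⟩ := exists_rightJacobson_pow_eq_bot (S := A)
  by_cases heJ : e ∈ rightJacobson A
  · have hpow : e ^ (k + 1) = e := IsIdempotentElem.pow_succ_eq k (hev e he)
    have h0 : e = 0 := by
      have := Ideal.pow_mem_pow_of_mem heJ k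
      rw [hk, Ideal.mem_bot] at this
      rw [← hpow, pow_succ, this, zero_mul]
    have hbot : ∀ v ∈ V, v = 0 := fun v hv => by rw [← hev v hv, h0, zero_mul]
    exact isUniserialModule_of_span_singleton fun x hx y _ =>
      Or.inl (hbot x hx ▸ Submodule.zero_mem _)
  set E := monomial φ 0 e with hE
  let l : SkewLaurentSeries φ →ₗ[(SkewLaurentSeries φ)ᵐᵒᵖ] SkewLaurentSeries φ :=
    { toFun := fun s => E * s
      map_add' := mul_add E
      map_smul' := fun s t => (mul_assoc E t _).symm }
  have hEV : E ∈ laurent φ V := monomial_mem_laurent.2 he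
  have hEv : ∀ f ∈ laurent φ V, E * f = f := fun f hf => by
    ext n
    rw [hE, coeff_monomial_mul, sub_zero, zpow_zero]
    exact hev _ (hf n)
  obtain ⟨i, y, hy, hyJ⟩ : ∃ i, ∃ y ∈ U i,
      E * y ∉ laurentIdeal (φ := φ) (rightJacobson A) zpow_mem_rightJacobson := by
    by_contra! h
    have hall : ∀ y ∈ ⨆ i, U i,
        E * y ∈ laurentIdeal (φ := φ) (rightJacobson A) zpow_mem_rightJacobson := by
      intro y hy
      refine Submodule.iSup_induction U
        (motive := fun y => E * y ∈ laurentIdeal (rightJacobson A) zpow_mem_rightJacobson) hy h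
        ?_ fun y z hy hz => ?_
      · rw [mul_zero]
        exact Ideal.zero_mem _
      · rw [mul_add]
        exact Ideal.add_mem _ hy hz
    have := hall 1 (hsup ▸ Submodule.mem_top) 0
    rw [mul_one, hE, coeff_monomial, if_pos rfl] at this
    exact heJ this
  obtain ⟨g, hg⟩ := exists_mul_eq_of_notMem_laurentIdeal hk he hev
    (fun c hc hcJ => exists_mul_eq_of_notMem_rightJacobson he hind hc hcJ)
    (rightIdeal_mul_mem _ y hEV) hyJ
  have hmap : laurent φ V = (U i).map l := by
    refine le_antisymm (fun f hf => ?_) ?_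
    · refine ⟨y * (g * f), rightIdeal_mul_mem _ _ hy, ?_⟩
      change E * (y * (g * f)) = f
      rw [← mul_assoc, ← mul_assoc, hg]
      exact hEv f hf
    · rintro _ ⟨s, -, rfl⟩
      exact rightIdeal_mul_mem _ s hEV
  have huni := (hU i).map l
  rw [← hmap] at huni
  exact isUniserialModule_iff.2 fun P hP Q hQ =>
    (isUniserialModule_iff.1 huni _ (laurent_le_laurent.2 hP) _ (laurent_le_laurent.2 hQ)).imp
      laurent_le_laurent.1 laurent_le_laurent.1

theorem coeff_isRightSerialRing [IsArtinian Aᵐᵒᵖ A]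
    (hs : IsRightSerialRing (SkewLaurentSeries φ)) : IsRightSerialRing A := by
  obtain ⟨ι, U, -, hsup, hU⟩ := isSerialModule_iff.1 hs
  have : WellFoundedLT (Submodule Aᵐᵒᵖ A) := ‹IsArtinian Aᵐᵒᵖ A›
  obtain ⟨s, hind, htop, hs⟩ := exists_supIndep_indecomposable (⊤ : Submodule Aᵐᵒᵖ A)
    ⟨⊥, isCompl_top_bot⟩
  refine isSerialModule_iff.2 ⟨s, fun P => P, ?_, ?_, fun P => ?_⟩
  · exact hind.independent
  · rw [← htop, Finset.sup_eq_iSup, iSup_subtype]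
    rfl
  · exact isUniserialModule_of_indecomposable hsup hU (hs P P.2).1 (hs P P.2).2

end SkewLaurentSeries

/-! ### Semiprime right Noetherian rings -/

section Semiprime

variable {S : Type*} [Ring S]

/-- The right annihilator of an element, as a right ideal. -/
def rightAnn (a : S) : Submodule Sᵐᵒᵖ S where
  carrier := {y | a * y = 0}
  add_mem' {y z} hy hz := by rw [Set.mem_ofPred_eq, mul_add, hy, hz, add_zero]
  zero_mem' := mul_zero a
  smul_mem' c y hy := by
    rw [Set.mem_ofPred_eq, MulOpposite.smul_eq_mul_unop, ← mul_assoc, hy, zero_mul]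

theorem mem_rightAnn {a y : S} : y ∈ rightAnn a ↔ a * y = 0 := Iff.rfl

variable [IsNoetherian Sᵐᵒᵖ S]

/-- Levitzki's theorem: a semiprime right Noetherian ring has no non-zero nil right ideals. If `a`
is a non-zero element of one, then `Sa` is nil as well, and `uSu = 0` for every non-zero `u ∈ Sa`
with maximal right annihilator. -/
theorem eq_bot_of_nil (hS : ∀ a : S, (∀ b, a * b * a = 0) → a = 0) {X : Submodule Sᵐᵒᵖ S}
    (hX : ∀ x ∈ X, IsNilpotent x) : X = ⊥ := by
  refine (Submodule.eq_bot_iff X).2 fun a ha => ?_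
  by_contra ha0
  have hnil : ∀ d, IsNilpotent (d * a) := by
    intro d
    obtain ⟨n, hn⟩ := hX _ (rightIdeal_mul_mem X d ha)
    have h : ∀ n : ℕ, (d * a) ^ (n + 1) = d * (a * d) ^ n * a := by
      intro n
      induction n with
      | zero => simp
      | succ n ih => rw [pow_succ, ih, pow_succ]; simp only [mul_assoc]
    exact ⟨n + 1, by rw [h, hn, mul_zero, zero_mul]⟩
  obtain ⟨_, ⟨c, hc0, rfl⟩, hmax⟩ := set_has_maximal_iff_noetherian.2 ‹IsNoetherian Sᵐᵒᵖ S›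
    {P | ∃ c, c * a ≠ 0 ∧ rightAnn (c * a) = P} ⟨_, 1, by rwa [one_mul], rfl⟩
  refine hc0 (hS _ fun b => ?_)
  set v := b * (c * a) with hv
  rw [mul_assoc, ← hv]
  by_cases hv0 : v = 0
  · rw [hv0, mul_zero]
  classical
  have hvn : ∃ n, v ^ n = 0 := by
    rw [hv, ← mul_assoc]
    exact hnil _
  obtain ⟨k, hk⟩ : ∃ k, Nat.find hvn = k + 1 := Nat.exists_eq_succ_of_ne_zero fun h => by
    have := Nat.find_spec hvn
    rw [h, pow_zero] at this
    exact hv0 (by rw [← mul_one v, this, mul_zero])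
  have hk1 : v ^ (k + 1) = 0 := hk ▸ Nat.find_spec hvn
  have hk0 : v ^ k ≠ 0 := Nat.find_min hvn (by omega)
  obtain ⟨j, rfl⟩ : ∃ j, k = j + 1 := Nat.exists_eq_succ_of_ne_zero fun h => hv0 (by
    rwa [h, zero_add, pow_one] at hk1)
  have hform : v ^ (j + 1) = v ^ j * b * c * a := by
    rw [pow_succ, hv]
    simp only [mul_assoc]
  have hle : rightAnn (c * a) ≤ rightAnn (v ^ j * b * c * a) := fun y hy => by
    rw [mem_rightAnn] at hy ⊢
    rw [mul_assoc _ c a, mul_assoc, hy, mul_zero]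
  have heq := hle.eq_or_lt.resolve_right (hmax _ ⟨_, hform ▸ hk0, rfl⟩)
  change v ∈ rightAnn (c * a)
  rw [heq, mem_rightAnn, ← hform, ← pow_succ, hk1]

/-- Every right ideal `L` of a semiprime right Noetherian ring contains an element whose right
annihilator meets `L` trivially. -/
theorem exists_mem_forall_mul_eq_zero (hS : ∀ a : S, (∀ b, a * b * a = 0) → a = 0)
    (L : Submodule Sᵐᵒᵖ S) : ∃ l ∈ L, ∀ y ∈ L, l * y = 0 → y = 0 := by
  obtain ⟨X, ⟨l, hl, hll, hX⟩, hmax⟩ := set_has_maximal_iff_noetherian.2 ‹IsNoetherian Sᵐᵒᵖ S›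
    {X | ∃ l ∈ L, (∀ y, l * (l * y) = 0 → l * y = 0) ∧ ∀ x ∈ X, l * x = 0 → x = 0}
    ⟨⊥, 0, L.zero_mem, fun y _ => zero_mul y, fun x hx _ => hx⟩
  by_contra! hne
  obtain ⟨y, hyL, hly, hy0⟩ := hne l hl
  obtain ⟨b, hb, hbn⟩ : ∃ b ∈ rightAnn l ⊓ L, ¬ IsNilpotent b := by
    by_contra! h
    have : y ∈ rightAnn l ⊓ L := ⟨hly, hyL⟩
    rw [eq_bot_of_nil hS h] at this
    exact hy0 this
  -- a power `c` of `b` with `r(c) = r(c²)`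
  obtain ⟨n, hn⟩ := monotone_stabilizes_iff_noetherian.2 ‹IsNoetherian Sᵐᵒᵖ S›
    ⟨fun n => rightAnn (b ^ n), monotone_nat_of_le_succ fun n y hy => by
      rw [mem_rightAnn] at hy ⊢
      rw [pow_succ', mul_assoc, hy, mul_zero]⟩
  obtain ⟨c, hlc, hcL, hc0, hcc⟩ : ∃ c, l * c = 0 ∧ c ∈ L ∧ c ≠ 0 ∧
      ∀ y, c * (c * y) = 0 → c * y = 0 := by
    have hc : b ^ (n + 1) ∈ rightAnn l ⊓ L := by
      rw [pow_succ']
      exact rightIdeal_mul_mem _ _ hb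
    refine ⟨b ^ (n + 1), hc.1, hc.2, fun h => hbn ⟨_, h⟩, fun y hy => ?_⟩
    rw [← mul_assoc, ← pow_add] at hy
    have h1 : y ∈ rightAnn (b ^ (n + 1 + (n + 1))) := hy
    have h2 : rightAnn (b ^ n) = rightAnn (b ^ (n + 1 + (n + 1))) := hn _ (by omega)
    have h3 : rightAnn (b ^ n) = rightAnn (b ^ (n + 1)) := hn _ (by omega)
    rw [← h2, h3] at h1
    exact h1
  have hann : ∀ y, (l + c) * y = 0 → l * y = 0 ∧ c * y = 0 := by
    intro y hy
    have h1 : l * (l * y) = 0 := by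
      have := congrArg (l * ·) hy
      simpa only [add_mul, mul_add, ← mul_assoc l c, hlc, zero_mul, add_zero, mul_zero] using this
    have h2 := hll y h1
    rw [add_mul, h2, zero_add] at hy
    exact ⟨h2, hy⟩
  refine hmax (X ⊔ Submodule.span Sᵐᵒᵖ {c})
    ⟨l + c, L.add_mem hl hcL, fun y hy => ?_, fun x hx hlx => ?_⟩
    (left_lt_sup.2 fun h => hc0 (hX c (h (Submodule.mem_span_singleton_self c)) hlc))
  · obtain ⟨h1, h2⟩ := hann _ hy
    have hly : l * y = 0 := hll y (by
      rwa [add_mul, mul_add, ← mul_assoc l c, hlc, zero_mul, add_zero] at h1)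
    rw [add_mul, hly, zero_add] at h2 ⊢
    exact hcc y h2
  · obtain ⟨ξ, hξ, w, hw, rfl⟩ := Submodule.mem_sup.1 hx
    obtain ⟨s, rfl⟩ := mem_span_singleton_right.1 hw
    obtain ⟨h1, h2⟩ := hann _ hlx
    rw [mul_add, ← mul_assoc l c, hlc, zero_mul, add_zero] at h1
    rw [hX ξ hξ h1, zero_add] at h2 ⊢
    exact hcc s h2

end Semiprime

/-! ### The radical of the series ring over a semiprime ring -/

namespace SkewLaurentSeries

variable {A : Type u} [Ring A] {φ : A ≃+* A}

/-- The lowest coefficient of a product, modulo an ideal that contains all earlier coefficients of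
the second factor. -/
theorem coeff_mul_sub_mem {K : Ideal A} (hK : ∀ i : ℤ, ∀ a ∈ K, (φ ^ i : RingAut A) a ∈ K)
    {f q : SkewLaurentSeries φ} (hf : ∀ n < 0, f.coeff n = 0) {r : ℤ}
    (hq : ∀ n < r, q.coeff n ∈ K) : (f * q).coeff r - f.coeff 0 * q.coeff r ∈ K := by
  have h : (f * q).coeff r - f.coeff 0 * q.coeff r =
      ((f - monomial φ 0 (f.coeff 0)) * q).coeff r := by
    rw [sub_mul, coeff_sub, coeff_monomial_mul, sub_zero, zpow_zero]
    rfl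
  rw [h]
  refine coeff_mul_mem K.toAddSubgroup fun i => ?_
  rw [coeff_sub, coeff_monomial]
  rcases lt_trichotomy i 0 with hi | rfl | hi
  · rw [hf i hi, if_neg hi.ne, sub_zero, zero_mul]
    exact K.zero_mem
  · rw [if_pos rfl, sub_self, zero_mul]
    exact K.zero_mem
  · exact K.mul_mem_left _ (hK _ _ (hq _ (by omega)))

/-- Over a semiprime right Noetherian ring the series ring has zero Jacobson radical. Let `L` be the
ideal of lowest coefficients of the radical, `l ∈ L` an element with `r(l) ∩ L = 0`, and `K` the
left annihilator of `L`; then `l y ∈ K` implies `y ∈ K`. If `f` is an element of the radical with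
lowest coefficient `l`, then a right inverse of `1 + f x⁻¹` shows that `l` is right invertible
modulo `K`. So, modulo `K((x, φ))`, the radical contains a unit, and `1 ∈ K`. -/
theorem eq_bot_of_forall_one_add [IsNoetherian Aᵐᵒᵖ A]
    (hA : ∀ a : A, (∀ b, a * b * a = 0) → a = 0) (I : Ideal (SkewLaurentSeries φ)) [I.IsTwoSided]
    (hI : ∀ f ∈ I, ∃ g, (1 + f) * g = 1) : I = ⊥ := by
  set L := lead I.toRight with hL
  have hLmul : ∀ b, ∀ a ∈ L, b * a ∈ L := by
    rintro b _ ⟨f, hf, hf0, rfl⟩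
    refine ⟨monomial φ 0 b * f, I.mul_mem_left _ hf, fun n hn => ?_, ?_⟩
    · rw [coeff_monomial_mul, sub_zero, hf0 n hn, map_zero, mul_zero]
    · rw [coeff_monomial_mul, sub_zero, zpow_zero]
      rfl
  have hLφ : ∀ i : ℤ, ∀ a ∈ L, (φ ^ i : RingAut A) a ∈ L := by
    rintro i _ ⟨f, hf, hf0, rfl⟩
    have hc : ∀ n, (monomial φ i 1 * f * monomial φ (-i) 1).coeff n =
        (φ ^ i : RingAut A) (f.coeff n) := fun n => by
      rw [coeff_mul_monomial, map_one, mul_one, coeff_monomial_mul, one_mul, sub_neg_eq_add,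
        add_sub_cancel_right]
    exact ⟨_, I.mul_mem_right _ (I.mul_mem_left _ hf), fun n hn => by rw [hc, hf0 n hn, map_zero],
      hc 0⟩
  let K : Ideal A :=
    { carrier := {y | ∀ z ∈ L, y * z = 0}
      add_mem' := fun hy hy' z hz => by rw [add_mul, hy z hz, hy' z hz, add_zero]
      zero_mem' := fun z _ => zero_mul z
      smul_mem' := fun b y hy z hz => by rw [smul_eq_mul, mul_assoc, hy z hz, mul_zero] }
  have hKmem : ∀ {y}, y ∈ K ↔ ∀ z ∈ L, y * z = 0 := Iff.rfl
  have hK2 : K.IsTwoSided := ⟨fun b hy z hz => by rw [mul_assoc, hy _ (hLmul b z hz)]⟩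
  have hKφ : ∀ i : ℤ, ∀ a ∈ K, (φ ^ i : RingAut A) a ∈ K := fun i y hy z hz => by
    have hz' : z = (φ ^ i : RingAut A) ((φ ^ (-i) : RingAut A) z) := by
      rw [← RingAut.mul_apply, ← zpow_add, add_neg_cancel, zpow_zero]
      rfl
    rw [hz', ← map_mul, hy _ (hLφ _ z hz), map_zero]
  suffices h1 : (1 : A) ∈ K by
    refine (Submodule.eq_bot_iff _).2 fun f hf => ?_
    by_contra hf0
    obtain ⟨m, hm, hlow⟩ := exists_minimal_index f (· ≠ 0) (fun h => h rfl) (by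
      by_contra! h
      exact hf0 (eq_zero_of_forall_coeff h))
    refine hm ?_
    have := h1 _ (coeff_mem_lead (I := I.toRight) hf fun n hn => not_not.1 (hlow n hn))
    rwa [one_mul] at this
  have hKI : ∀ f : SkewLaurentSeries φ, f ∈ laurentIdeal K hKφ → (∃ g, f * g = 1) → (1 : A) ∈ K := by
    rintro f hf ⟨g, hg⟩
    have := (laurentIdeal K hKφ).mul_mem_right g hf 0
    rwa [hg, coeff_one, if_pos rfl] at this
  obtain ⟨l, ⟨f, hfI, hf0, rfl⟩, hlL⟩ := exists_mem_forall_mul_eq_zero hA L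
  have hlK : ∀ y, f.coeff 0 * y ∈ K → y ∈ K := fun y hy z hz =>
    hlL _ (hLmul y z hz) (by rw [← mul_assoc, hy z hz])
  obtain ⟨g, hg⟩ := hI (f * monomial φ (-1) 1) (I.mul_mem_right _ hfI)
  by_cases hgK : g ∈ laurentIdeal K hKφ
  · have := (laurentIdeal K hKφ).mul_mem_left (1 + f * monomial φ (-1) 1) hgK 0
    rwa [hg, coeff_one, if_pos rfl] at this
  obtain ⟨m, hm, hlow⟩ := exists_minimal_index g (· ∉ K) (fun h => h K.zero_mem)
    (by simpa [mem_laurentIdeal] using hgK)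
  set q := monomial φ (-1) 1 * g with hq
  have hqc : ∀ n, q.coeff n = (φ ^ (-1 : ℤ) : RingAut A) (g.coeff (n + 1)) := fun n => by
    rw [hq, coeff_monomial_mul, one_mul, sub_neg_eq_add]
  have hqm : q.coeff (m - 1) ∉ K := fun h => hm <| by
    have := hKφ 1 _ h
    rwa [hqc, ← RingAut.mul_apply, ← zpow_add, add_neg_cancel, zpow_zero, sub_add_cancel] at this
  have hfq := coeff_mul_sub_mem hKφ hf0 (r := m - 1) (q := q) fun n hn => by
    rw [hqc]
    exact hKφ _ _ (not_not.1 (hlow _ (by omega)))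
  have hcoef := congrArg (fun h => coeff h (m - 1)) hg
  rw [add_mul, one_mul, mul_assoc, ← hq, coeff_add, coeff_one] at hcoef
  have hgm : g.coeff (m - 1) ∈ K := not_not.1 (hlow _ (by omega))
  have hlq : f.coeff 0 * q.coeff (m - 1) - (if m - 1 = 0 then 1 else 0) ∈ K := by
    rw [← hcoef]
    have := K.neg_mem (K.add_mem hgm hfq)
    convert this using 1
    abel
  by_cases hm1 : m - 1 = 0
  swap
  · rw [if_neg hm1, sub_zero] at hlq
    exact absurd (hlK _ hlq) hqm
  rw [if_pos hm1] at hlq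
  -- `z` is an element of the radical with lowest coefficient `l y ≡ 1`
  set y := q.coeff (m - 1)
  set c := f.coeff 0 * y - 1 with hc
  set z := f * monomial φ 0 y with hz
  have hzc : ∀ n, z.coeff n = f.coeff n * (φ ^ n : RingAut A) y := fun n => by
    rw [hz, coeff_mul_monomial, sub_zero]
  obtain ⟨w, hw⟩ := exists_mul_eq_one (f := z - monomial φ 0 c)
    (fun n hn => by
      rw [coeff_sub, hzc, hf0 n hn, zero_mul, coeff_monomial, if_neg hn.ne, sub_zero])
    (by
      rw [coeff_sub, hzc, coeff_monomial, if_pos rfl, zpow_zero, hc]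
      exact sub_sub_cancel _ _)
  have hzw : -(z * w) ∈ I := I.neg_mem (I.mul_mem_right _ (I.mul_mem_right _ hfI))
  refine hKI _ ?_ (hI _ hzw)
  have h1 : 1 + -(z * w) = -(monomial φ 0 c * w) := by
    rw [← hw, sub_mul]
    abel
  rw [h1]
  refine Submodule.neg_mem _ ((laurentIdeal K hKφ).mul_mem_right _ fun n => ?_)
  rw [coeff_monomial]
  split_ifs
  exacts [hlq, K.zero_mem]

end SkewLaurentSeries

/-! ### The largest nilpotent ideal of a right Noetherian ring -/

section Nilpotent

variable {S : Type*} [Ring S]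

/-- A right Noetherian ring has a nilpotent two-sided ideal `N` with `S/N` semiprime. -/
theorem exists_nilpotent_semiprime_quotient [IsNoetherian Sᵐᵒᵖ S] :
    ∃ N : Ideal S, N.IsTwoSided ∧ (∃ k, N ^ k = ⊥) ∧
      ∀ a : S, (∀ b, a * b * a ∈ N) → a ∈ N := by
  obtain ⟨_, ⟨N, hN, ⟨k, hk⟩, rfl⟩, hmax⟩ := set_has_maximal_iff_noetherian.2
    ‹IsNoetherian Sᵐᵒᵖ S›
    {P | ∃ (N : Ideal S) (_ : N.IsTwoSided), (∃ k, N ^ k = ⊥) ∧ N.toRight = P}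
    ⟨_, ⊥, inferInstance, ⟨1, Submodule.pow_one _⟩, rfl⟩
  refine ⟨N, hN, ⟨k, hk⟩, fun a ha => ?_⟩
  -- the two-sided ideal generated by `a`, whose square is contained in `N`
  let D : Ideal S := (TwoSidedIdeal.span {a}).asIdeal
  have haD : a ∈ D := TwoSidedIdeal.subset_span rfl
  have hDle : ∀ M : Ideal S, M.IsTwoSided → a ∈ M → D ≤ M := fun M _ haM x hx => by
    have h : TwoSidedIdeal.span {a} ≤ M.toTwoSided :=
      TwoSidedIdeal.span_le.2 (Set.singleton_subset_iff.2 (Ideal.mem_toTwoSided.2 haM))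
    exact Ideal.mem_toTwoSided.1 (h hx)
  have hDD : ∀ r ∈ D, ∀ s ∈ D, r * s ∈ N := by
    let M : Ideal S :=
      { carrier := {s | ∀ b, a * b * s ∈ N}
        add_mem' := fun hs ht b => by rw [mul_add]; exact N.add_mem (hs b) (ht b)
        zero_mem' := fun b => by rw [mul_zero]; exact N.zero_mem
        smul_mem' := fun c s hs b => by
          rw [smul_eq_mul, ← mul_assoc, mul_assoc a]
          exact hs _ }
    have hM : M.IsTwoSided := ⟨fun c hs b => by
      rw [← mul_assoc]
      exact N.mul_mem_right c (hs b)⟩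
    have h1 := hDle M hM ha
    let M' : Ideal S :=
      { carrier := {r | ∀ s ∈ D, r * s ∈ N}
        add_mem' := fun hr ht s hs => by rw [add_mul]; exact N.add_mem (hr s hs) (ht s hs)
        zero_mem' := fun s _ => by rw [zero_mul]; exact N.zero_mem
        smul_mem' := fun c r hr s hs => by
          rw [smul_eq_mul, mul_assoc]
          exact N.mul_mem_left c (hr s hs) }
    have hM' : M'.IsTwoSided := ⟨fun c hr s hs => by
      rw [mul_assoc]
      exact hr _ (D.mul_mem_left c hs)⟩
    exact hDle M' hM' fun s hs => by simpa using h1 hs 1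
  have hsup : (N ⊔ D).IsTwoSided := ⟨fun b hx => by
    obtain ⟨y, hy, z, hz, rfl⟩ := Submodule.mem_sup.1 hx
    rw [add_mul]
    exact Submodule.add_mem_sup (N.mul_mem_right b hy) (D.mul_mem_right b hz)⟩
  have hsq : (N ⊔ D) * (N ⊔ D) ≤ N := Ideal.mul_le.2 fun x hx y hy => by
    obtain ⟨x₁, hx₁, x₂, hx₂, rfl⟩ := Submodule.mem_sup.1 hx
    obtain ⟨y₁, hy₁, y₂, hy₂, rfl⟩ := Submodule.mem_sup.1 hy
    rw [add_mul, mul_add x₂]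
    exact N.add_mem (N.mul_mem_right _ hx₁) (N.add_mem (N.mul_mem_left _ hy₁) (hDD _ hx₂ _ hy₂))
  have hpow : ∀ j, (N ⊔ D) ^ (2 * j) ≤ N ^ j := by
    intro j
    induction j with
    | zero => rw [mul_zero, Submodule.pow_zero, Submodule.pow_zero]
    | succ j ih =>
      rw [mul_add, Ideal.IsTwoSided.pow_add, Submodule.pow_succ (n := j)]
      refine Ideal.mul_mono ih ?_
      rwa [mul_one, Submodule.pow_succ, Submodule.pow_one]
  have hle : N.toRight ≤ (N ⊔ D).toRight := fun x hx => Submodule.mem_sup_left hx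
  have heq := hle.eq_or_lt.resolve_right
    (hmax _ ⟨N ⊔ D, hsup, ⟨2 * k, le_bot_iff.1 (hk ▸ hpow k)⟩, rfl⟩)
  have : a ∈ (N ⊔ D).toRight := Submodule.mem_sup_right haD
  rw [← heq] at this
  exact this

/-- An ideal with semiprime quotient contains all nilpotent ideals. -/
theorem le_of_pow_eq_bot {N : Ideal S} (hN : ∀ a : S, (∀ b, a * b * a ∈ N) → a ∈ N)
    {D : Ideal S} [D.IsTwoSided] {k : ℕ} (hk : D ^ k = ⊥) : D ≤ N := by
  have step : ∀ j, D ^ (j + 1 + 1) ≤ N → D ^ (j + 1) ≤ N := fun j hj a ha => hN a fun b => by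
    have hle : D ^ (j + 1) ≤ D := by
      rw [Submodule.pow_succ]
      exact Ideal.mul_le_right
    refine hj ?_
    rw [Submodule.pow_succ (n := j + 1)]
    exact Ideal.mul_mem_mul (Ideal.mul_mem_right b _ ha) (hle ha)
  have : ∀ j, D ^ (j + 1) ≤ N → D ≤ N := by
    intro j
    induction j with
    | zero => intro h; rwa [zero_add, Submodule.pow_one] at h
    | succ j ih => exact fun h => ih (step j h)
  refine this k ?_
  rw [Submodule.pow_succ]
  exact Ideal.mul_le.2 fun r hr s _ => by
    rw [hk, Ideal.mem_bot] at hr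
    rw [hr, zero_mul]
    exact N.zero_mem

/-- The largest nilpotent ideal is invariant under automorphisms. -/
theorem mem_of_map_mem {N : Ideal S} [N.IsTwoSided] {k : ℕ} (hk : N ^ k = ⊥)
    (hN : ∀ a : S, (∀ b, a * b * a ∈ N) → a ∈ N) (ψ : S ≃+* S) {a : S} (ha : ψ a ∈ N) : a ∈ N := by
  let D : Ideal S := N.comap (ψ : S →+* S)
  have hD : D.IsTwoSided := ⟨fun b hx => by
    change ψ (_ * b) ∈ N
    rw [map_mul]
    exact N.mul_mem_right _ hx⟩
  have hpow : ∀ j, ∀ x ∈ D ^ j, ψ x ∈ N ^ j := by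
    intro j
    induction j with
    | zero => exact fun x _ => by rw [Submodule.pow_zero, Ideal.one_eq_top]; trivial
    | succ j ih =>
      intro x hx
      rw [Submodule.pow_succ] at hx ⊢
      refine Submodule.mul_induction_on hx (fun r hr s hs => ?_) fun r s hr hs => ?_
      · rw [map_mul]
        exact Ideal.mul_mem_mul (ih r hr) hs
      · rw [map_add]
        exact Ideal.add_mem _ hr hs
  refine le_of_pow_eq_bot hN (D := D) (k := k) ((Submodule.eq_bot_iff _).2 fun x hx => ?_) ha
  have := hpow k x hx
  rw [hk, Ideal.mem_bot] at this
  exact ψ.injective (this.trans (map_zero ψ).symm)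

theorem isNoetherian_right_of_surjective {S' : Type*} [Ring S'] [IsNoetherian Sᵐᵒᵖ S] (q : S →+* S')
    (hq : Function.Surjective q) : IsNoetherian S'ᵐᵒᵖ S' := by
  have := isNoetherianRing_op_iff.2 ‹IsNoetherian Sᵐᵒᵖ S›
  have := isNoetherianRing_of_surjective Sᵐᵒᵖ S'ᵐᵒᵖ q.op
    (fun y => (hq y.unop).imp' op fun _ h => unop_injective h)
  exact isNoetherianRing_op_iff.1 this

end Nilpotent

namespace SkewLaurentSeries

/-! ### The radical of the series ring over a right Noetherian ring -/

section Map

variable {A B : Type*} [Ring A] [Ring B] {φ : A ≃+* A} {ψ : B ≃+* B}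

theorem map_zpow_comm {q : A →+* B} (hq : ∀ a, q (φ a) = ψ (q a)) (i : ℤ) :
    ∀ a, q ((φ ^ i : RingAut A) a) = (ψ ^ i : RingAut B) (q a) := by
  induction i using Int.induction_on with
  | zero => exact fun a => rfl
  | succ i ih =>
    intro a
    rw [zpow_add_one, zpow_add_one, RingAut.mul_apply, RingAut.mul_apply, ih]
    exact congrArg _ (hq a)
  | pred i ih =>
    intro a
    rw [zpow_sub_one, zpow_sub_one, RingAut.mul_apply, RingAut.mul_apply, ih]
    refine congrArg _ (ψ.injective ?_)
    rw [← hq]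
    change q (φ (φ.symm a)) = ψ (ψ.symm (q a))
    rw [φ.apply_symm_apply, ψ.apply_symm_apply]

/-- The coefficientwise homomorphism of series rings induced by a ring homomorphism that commutes
with the automorphisms. -/
def mapRingHom (q : A →+* B) (hq : ∀ a, q (φ a) = ψ (q a)) :
    SkewLaurentSeries φ →+* SkewLaurentSeries ψ where
  toFun f := ⟨fun n => q (f.coeff n), by
    obtain ⟨m, hm⟩ := f.bddBelow'
    exact ⟨m, fun n hn => by rw [hm n hn, map_zero]⟩⟩
  map_zero' := eq_zero_of_forall_coeff fun n => map_zero q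
  map_one' := by
    ext n
    simp only [coeff_one]
    split_ifs <;> simp
  map_add' f g := by
    ext n
    exact map_add q _ _
  map_mul' f g := by
    obtain ⟨a, ha⟩ := f.bddBelow'
    obtain ⟨b, hb⟩ := g.bddBelow'
    ext n
    rw [coeff_mul_eq_sum (a := a) (b := b) (fun i hi => by simp [ha i hi])
      (fun i hi => by simp [hb i hi]) le_rfl le_rfl]
    simp only [coeff_mul_eq_sum ha hb le_rfl le_rfl, map_sum, map_mul, map_zpow_comm hq]

theorem coeff_mapRingHom {q : A →+* B} {hq : ∀ a, q (φ a) = ψ (q a)} (f : SkewLaurentSeries φ)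
    (n : ℤ) : (mapRingHom q hq f).coeff n = q (f.coeff n) := rfl

theorem mapRingHom_surjective {q : A →+* B} {hq : ∀ a, q (φ a) = ψ (q a)}
    (hs : Function.Surjective q) : Function.Surjective (mapRingHom q hq) := by
  classical
  intro g
  obtain ⟨m, hm⟩ := g.bddBelow'
  choose s hs using hs
  refine ⟨⟨fun n => if n < m then 0 else s (g.coeff n), m, fun n hn => if_pos hn⟩, ?_⟩
  ext n
  rw [coeff_mapRingHom]
  dsimp only
  split_ifs with h
  · rw [map_zero, hm n h]
  · exact hs _

end Map

variable {A : Type u} [Ring A] {φ : A ≃+* A}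

/-- The radical of the series ring over a right Noetherian ring `A` is nilpotent: its coefficients
lie in the largest nilpotent ideal of `A`. -/
theorem exists_rightJacobson_laurent_pow_eq_bot [IsNoetherian Aᵐᵒᵖ A] :
    ∃ k, rightJacobson (SkewLaurentSeries φ) ^ k = ⊥ := by
  obtain ⟨N, hN, ⟨k, hk⟩, hsp⟩ := exists_nilpotent_semiprime_quotient (S := A)
  have hle : N ≤ N.comap (φ : A →+* A) := fun a ha =>
    mem_of_map_mem hk hsp φ.symm (by simpa using ha)
  have hle' : N ≤ N.comap (φ.symm : A →+* A) := fun a ha =>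
    mem_of_map_mem hk hsp φ (by simpa using ha)
  have hstable := zpow_mem_of_mem (φ := φ) (I := N) (fun a ha => hle ha) fun a ha => hle' ha
  let ψ : A ⧸ N ≃+* A ⧸ N :=
    { Ideal.quotientMap N (φ : A →+* A) hle with
      invFun := Ideal.quotientMap N (φ.symm : A →+* A) hle'
      left_inv := by
        rintro ⟨a⟩
        exact congrArg (Ideal.Quotient.mk N) (φ.symm_apply_apply a)
      right_inv := by
        rintro ⟨a⟩
        exact congrArg (Ideal.Quotient.mk N) (φ.apply_symm_apply a) }
  let q := Ideal.Quotient.mk N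
  have hq : Function.Surjective q := Ideal.Quotient.mk_surjective
  have hqψ : ∀ a, q (φ a) = ψ (q a) := fun a => rfl
  have hπ := mapRingHom_surjective (hq := hqψ) hq
  have : IsNoetherian (A ⧸ N)ᵐᵒᵖ (A ⧸ N) := isNoetherian_right_of_surjective q hq
  have : RingHomSurjective (mapRingHom q hqψ) := ⟨hπ⟩
  have hbot := eq_bot_of_forall_one_add (A := A ⧸ N) (fun a ha => by
    obtain ⟨a, rfl⟩ := hq a
    refine Ideal.Quotient.eq_zero_iff_mem.2 (hsp a fun b => Ideal.Quotient.eq_zero_iff_mem.1 ?_)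
    rw [map_mul, map_mul]
    exact ha (q b)) ((rightJacobson (SkewLaurentSeries φ)).map (mapRingHom q hqψ)) fun f hf => by
      obtain ⟨f', hf', rfl⟩ := (Ideal.mem_map_iff_of_surjective _ hπ).1 hf
      obtain ⟨g, hg⟩ := exists_one_add_mul_eq_one hf'
      exact ⟨mapRingHom q hqψ g, by rw [← map_one (mapRingHom q hqψ), ← map_add, ← map_mul, hg]⟩
  refine ⟨k, pow_eq_bot_of_le_laurentIdeal (hI := hstable) (fun f hf n => ?_) hk⟩
  have h0 := Ideal.mem_map_of_mem (mapRingHom q hqψ) hf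
  rw [hbot, Ideal.mem_bot] at h0
  refine Ideal.Quotient.eq_zero_iff_mem.1 ?_
  exact congrArg (fun h => coeff h n) h0

/-- The series ring is right Noetherian because `A` is, semisimple modulo its radical because it is
serial, and its radical is nilpotent; so it is right Artinian by the Hopkins–Levitzki theorem. -/
theorem isArtinian_of_isRightSerialRing (hs : IsRightSerialRing (SkewLaurentSeries φ)) :
    IsArtinian (SkewLaurentSeries φ)ᵐᵒᵖ (SkewLaurentSeries φ) := by
  have := coeff_isNoetherian hs
  have := isNoetherianRing_op_iff.2 (isNoetherian_of_coeff (φ := φ))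
  obtain ⟨ι, U, -, hsup, hU⟩ := isSerialModule_iff.1 hs
  let e := rightRegularEquiv (SkewLaurentSeries φ)
  obtain ⟨k, hk⟩ := exists_rightJacobson_laurent_pow_eq_bot (φ := φ)
  have : IsSemiprimaryRing (SkewLaurentSeries φ)ᵐᵒᵖ :=
    { isSemisimpleRing := isSemisimpleRing_quotient_jacobson
        (U := fun i => (U i).map e.toLinearMap)
        (by rw [← Submodule.map_iSup, hsup, Submodule.map_top]; exact LinearEquiv.range e)
        fun i => (hU i).map e.toLinearMap
      isNilpotent := ⟨k, (Submodule.eq_bot_iff _).2 fun f hf => unop_injective <| by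
        have := unop_mem_pow (I := rightJacobson (SkewLaurentSeries φ)) (fun _ h => h) k f hf
        rwa [hk, Ideal.mem_bot] at this⟩ }
  exact isArtinianRing_op_iff.1 (IsSemiprimaryRing.isNoetherian_iff_isArtinian.1 ‹_›)

end SkewLaurentSeries

theorem theorem1 {A : Type u} [Ring A] (φ : A ≃+* A) :
    List.TFAE [
      IsRightSerialRing (SkewLaurentSeries φ),
      IsRightSerialRing (SkewLaurentSeries φ) ∧ IsRightArtinianRing (SkewLaurentSeries φ),
      IsRightSerialRing A ∧ IsRightArtinianRing A] := by
  tfae_have 1 → 2 := fun h => ⟨h, SkewLaurentSeries.isArtinian_of_isRightSerialRing h⟩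
  tfae_have 2 → 3 := fun ⟨hs, ha⟩ => by
    have : IsArtinian (SkewLaurentSeries φ)ᵐᵒᵖ (SkewLaurentSeries φ) := ha
    have : IsArtinian Aᵐᵒᵖ A := SkewLaurentSeries.coeff_isArtinian (φ := φ)
    exact ⟨SkewLaurentSeries.coeff_isRightSerialRing hs, this⟩
  tfae_have 3 → 1 := fun ⟨hs, ha⟩ => SkewLaurentSeries.isRightSerialRing_of_coeff hs ha
  tfae_finish
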